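/- Let $n\ge 1$ be an integer and $\alpha>0$. Let $$\mathcal M_\alpha=\Big\{(b_1,\dots,b_n,a_1,\dots,a_n)\in\mathbb R^n\times\mathbb R^n_{>0}\ \Big|\ \sum_{i=1}^n b_i=0,\ \prod_{i=1}^n a_i=\alpha^n\Big\},$$ a submanifold of $\mathbb R^{2n}$, and let $\omega_\alpha$ be the restriction to $\mathcal M_\alpha$ of the 2-form $2\sum_{i=2}^n\sum_{j=1}^{i-1} db_i\wedge \frac{da_j}{a_j}$. For $(b,a)\in\mathcal M_\alpha$ extend $a_k,b_k$ to all $k\in\mathbb Z$ with period $n$, and let $y_1(k,\lambda)$, $y_2(k,\lambda)$ be the solutions of $$a_{k-1}y(k-1,\lambda)+b_k y(k,\lambda)+a_k y(k+1,\lambda)=\lambda y(k,\lambda),\qquad k=1,2,\dots,$$ with $y_1(0,\lambda)=1$, $y_1(1,\lambda)=0$, $y_2(0,\lambda)=0$, $y_2(1,\lambda)=1$; they are polynomials in $\lambda$. Then $y_1(n+1,\lambda)$ has degree $n-1$ in $\lambda$ and all its roots are real. Let $\mu_1\le\dots\le\mu_{n-1}$ be these roots, listed with multiplicity (the Dirichlet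 eigenvalues). One has $y_2(n+1,\mu_i)\ne 0$ for all $i$; put $f_i=\log|y_2(n+1,\mu_i)|$, and define $$\phi_\alpha:\mathcal M_\alpha\to\mathbb R^{2n-2},\qquad \phi_\alpha(b,a)=(f_1,\dots,f_{n-1},\mu_1,\dots,\mu_{n-1}).$$ Then: 1. The image $\phi_\alpha(\mathcal M_\alpha)$ is exactly the set of all $(f_1,\dots,f_{n-1},\mu_1,\dots,\mu_{n-1})\in\mathbb R^{2n-2}$ with $\mu_1<\mu_2<\dots<\mu_{n-1}$. 2. $\phi_\alpha$ is a symplectomorphism from $(\mathcal M_\alpha,\omega_\alpha)$ onto $\big(\phi_\alpha(\mathcal M_\alpha),\ \omega_0=\sum_{i=1}^{n-1}d\mu_i\wedge df_i\big)$, i.e. a diffeomorphism onto its image with $\phi_\alpha^*\omega_0=\omega_\alpha$. 3. In particular, the 1-form $-\phi_\alpha^*\big(\sum_{i=1}^{n-1}f_i\,d\mu_i\big)$ is a primitive of $\omega_\alpha$, i.e. $d\,\phi_\alpha^*\big(\sum_{i=1}^{n-1} f_i\,d\mu_i\big)=-\omega_\alpha$. -/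

import Mathlib

open Polynomial
open scoped ContDiff

noncomputable section

/-! ### Calculus on submanifolds of a normed space -/

section Submanifold

variable {E F : Type*} [NormedAddCommGroup E] [NormedSpace ℝ E]
  [NormedAddCommGroup F] [NormedSpace ℝ F]

/-- A map is smooth on a subset `M` of a normed space if near every point of `M` it agrees on `M`
with a smooth map that is defined on an open subset of the ambient space. -/
def SmoothOnSubset (f : E → F) (M : Set E) : Prop :=
  ∀ x ∈ M, ∃ W : Set E, IsOpen W ∧ x ∈ W ∧ ∃ g : E → F, ContDiffOn ℝ ∞ g W ∧ Set.EqOn g f (W ∩ M)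

/-- Two `k`-forms, given on the ambient space, have the same restriction to `M` at `x`: they agree
on all tuples of vectors tangent to `M` at `x`. For an embedded submanifold `M`, the set
`tangentConeAt ℝ M x` is the tangent space of `M` at `x`. -/
def FormEqAt {k : ℕ} (M : Set E) (x : E) (η η' : E [⋀^Fin k]→L[ℝ] ℝ) : Prop :=
  ∀ v : Fin k → E, (∀ i, v i ∈ tangentConeAt ℝ M x) → η v = η' v

/-- The pullback `φ^* β` of a form `β` along a smooth map `φ` on `M`. The map `fderivWithin ℝ φ M x`
is a derivative of `φ` within `M`; on vectors tangent to `M` at `x`, where alone the pullback is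
used, all such derivatives agree and are the differential of `φ` restricted to `M`. -/
def pullbackForm {k : ℕ} (φ : E → F) (M : Set E) (β : F → F [⋀^Fin k]→L[ℝ] ℝ) :
    E → E [⋀^Fin k]→L[ℝ] ℝ :=
  fun x => (β (φ x)).compContinuousLinearMap (fderivWithin ℝ φ M x)

/-- `φ` is a diffeomorphism from the submanifold `M` onto the submanifold `N` with `φ^* η = σ`
on `M`. -/
structure IsSymplectomorphismOn (φ : E → F) (M : Set E) (σ : E → E [⋀^Fin 2]→L[ℝ] ℝ)
    (N : Set F) (η : F → F [⋀^Fin 2]→L[ℝ] ℝ) : Prop where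
  bijOn : Set.BijOn φ M N
  smooth : SmoothOnSubset φ M
  smooth_inverse : ∃ ψ : F → E, Set.InvOn ψ φ M N ∧ SmoothOnSubset ψ N
  pullback_eq : ∀ x ∈ M, FormEqAt M x (pullbackForm φ M η x) (σ x)

/-- `θ` is a primitive of `η` on the submanifold `M`, that is `dθ = η` on `M`: near each point of
`M`, the form `θ` on `M` is the restriction of a smooth form `Θ` on an open subset of the ambient
space, and `η` is the restriction of `dΘ`. -/
def IsPrimitiveOn {k : ℕ} (M : Set E) (θ : E → E [⋀^Fin k]→L[ℝ] ℝ)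
    (η : E → E [⋀^Fin (k + 1)]→L[ℝ] ℝ) : Prop :=
  ∀ x ∈ M, ∃ W : Set E, IsOpen W ∧ x ∈ W ∧ ∃ Θ : E → E [⋀^Fin k]→L[ℝ] ℝ,
    ContDiffOn ℝ ∞ Θ W ∧
    (∀ y ∈ W ∩ M, FormEqAt M y (Θ y) (θ y)) ∧
    (∀ y ∈ W ∩ M, FormEqAt M y (extDeriv Θ y) (η y))

/-- A continuous linear functional as an alternating `1`-form. -/
def oneForm (l : E →L[ℝ] ℝ) : E [⋀^Fin 1]→L[ℝ] ℝ :=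
  ContinuousAlternatingMap.ofSubsingleton ℝ E ℝ (0 : Fin 1) l

/-- The wedge product `l ∧ m` of two linear functionals,
`(l ∧ m)(u, v) = l(u) m(v) - l(v) m(u)`. -/
def wedge (l m : E →L[ℝ] ℝ) : E [⋀^Fin 2]→L[ℝ] ℝ :=
  ContinuousMultilinearMap.alternatization
    ((ContinuousMultilinearMap.mkPiAlgebra ℝ (Fin 2) ℝ).compContinuousLinearMap ![l, m])

theorem oneForm_apply (l : E →L[ℝ] ℝ) (v : Fin 1 → E) : oneForm l v = l (v 0) := rfl

theorem wedge_apply (l m : E →L[ℝ] ℝ) (v : Fin 2 → E) :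
    wedge l m v = l (v 0) * m (v 1) - l (v 1) * m (v 0) := by
  have h : (Finset.univ : Finset (Equiv.Perm (Fin 2))) = {1, Equiv.swap 0 1} := by decide
  have h1 : (1 : Equiv.Perm (Fin 2)) ∉ ({Equiv.swap 0 1} : Finset (Equiv.Perm (Fin 2))) := by decide
  rw [wedge, ContinuousMultilinearMap.alternatization_apply_apply, h, Finset.sum_insert h1,
    Finset.sum_singleton]
  simp [Fin.prod_univ_two]
  ring

end Submanifold

/-! ### The periodic Toda lattice in Flaschka variables -/

namespace Toda

/-- The space of pairs `x = (b, a)` with `b, a` real and indexed modulo `n`; thus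
`b_k = x.1 (k : ZMod n)` and `a_k = x.2 (k : ZMod n)` for every integer `k`, and `a_0 = a_n`. -/
abbrev Flaschka (n : ℕ) : Type := (ZMod n → ℝ) × (ZMod n → ℝ)

/-- The space of pairs `z = (f, μ)` with `f, μ ∈ ℝ^(n-1)`; here `f_i = z.1 (i - 1)` and
`μ_i = z.2 (i - 1)` for `1 ≤ i ≤ n - 1`. -/
abbrev Target (n : ℕ) : Type := (Fin (n - 1) → ℝ) × (Fin (n - 1) → ℝ)

variable {n : ℕ}

/-- The solution `y(k, λ)`, a polynomial in `λ`, of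
`a_{k-1} y(k-1, λ) + b_k y(k, λ) + a_k y(k+1, λ) = λ y(k, λ)` for `k = 1, 2, …`,
with initial values `y(0, λ) = s₀` and `y(1, λ) = s₁`. -/
def solution (x : Flaschka n) (s₀ s₁ : ℝ) : ℕ → ℝ[X]
  | 0 => C s₀
  | 1 => C s₁
  | k + 2 => C (x.2 ((k + 1 : ℕ) : ZMod n))⁻¹ *
      ((X - C (x.1 ((k + 1 : ℕ) : ZMod n))) * solution x s₀ s₁ (k + 1)
        - C (x.2 ((k : ℕ) : ZMod n)) * solution x s₀ s₁ k)

/-- The fundamental solution with `y₁(0, λ) = 1` and `y₁(1, λ) = 0`. -/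
def y₁ (x : Flaschka n) (k : ℕ) : ℝ[X] := solution x 1 0 k

/-- The fundamental solution with `y₂(0, λ) = 0` and `y₂(1, λ) = 1`. -/
def y₂ (x : Flaschka n) (k : ℕ) : ℝ[X] := solution x 0 1 k

/-- The Dirichlet eigenvalues `μ_1 ≤ … ≤ μ_{n-1}`: the roots of `y₁(n+1, λ)`, with multiplicity,
in increasing order. The default value `0` of `getD` is not used when there are `n - 1` roots. -/
def dirichlet (x : Flaschka n) (i : Fin (n - 1)) : ℝ :=
  ((y₁ x (n + 1)).roots.sort (fun s t => s ≤ t)).getD i 0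

/-- The map sending `(b, a)` to `(f, μ)`, where `f_i = log |y₂(n+1, μ_i)|`. -/
def floquetMap (x : Flaschka n) : Target n :=
  (fun i => Real.log |(y₂ x (n + 1)).eval (dirichlet x i)|, dirichlet x)

/-- The coordinate function `b_k` as a linear functional, hence the `1`-form `db_k`. -/
def db (n : ℕ) (k : ZMod n) : Flaschka n →L[ℝ] ℝ :=
  (ContinuousLinearMap.proj k).comp (ContinuousLinearMap.fst ℝ (ZMod n → ℝ) (ZMod n → ℝ))

/-- The `1`-form `da_k`. -/
def da (n : ℕ) (k : ZMod n) : Flaschka n →L[ℝ] ℝ :=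
  (ContinuousLinearMap.proj k).comp (ContinuousLinearMap.snd ℝ (ZMod n → ℝ) (ZMod n → ℝ))

/-- The `1`-form `df_i`. -/
def df (n : ℕ) (i : Fin (n - 1)) : Target n →L[ℝ] ℝ :=
  (ContinuousLinearMap.proj i).comp (ContinuousLinearMap.fst ℝ (Fin (n - 1) → ℝ) (Fin (n - 1) → ℝ))

/-- The `1`-form `dμ_i`. -/
def dμ (n : ℕ) (i : Fin (n - 1)) : Target n →L[ℝ] ℝ :=
  (ContinuousLinearMap.proj i).comp (ContinuousLinearMap.snd ℝ (Fin (n - 1) → ℝ) (Fin (n - 1) → ℝ))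

/-- The phase space `𝓜_α`: all `(b, a)` with `a_i > 0`, `∑ b_i = 0` and `∏ a_i = α^n`. -/
def phaseSpace (n : ℕ) [NeZero n] (α : ℝ) : Set (Flaschka n) :=
  {x | (∀ i, 0 < x.2 i) ∧ ∑ i, x.1 i = 0 ∧ ∏ i, x.2 i = α ^ n}

/-- The `2`-form `2 ∑_{i=2}^n ∑_{j=1}^{i-1} db_i ∧ da_j / a_j`, whose restriction to `𝓜_α` is the
symplectic form `ω_α`. -/
def todaForm (n : ℕ) [NeZero n] (x : Flaschka n) : Flaschka n [⋀^Fin 2]→L[ℝ] ℝ :=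
  (2 : ℝ) • ∑ i ∈ Finset.Icc 2 n, ∑ j ∈ Finset.Icc 1 (i - 1),
    wedge (db n (i : ZMod n)) ((x.2 (j : ZMod n))⁻¹ • da n (j : ZMod n))

/-- The standard symplectic form `ω₀ = ∑ dμ_i ∧ df_i` on the space of all `(f, μ)`. -/
def stdForm (n : ℕ) (_z : Target n) : Target n [⋀^Fin 2]→L[ℝ] ℝ :=
  ∑ i, wedge (dμ n i) (df n i)

/-- The `1`-form `∑ f_i dμ_i` on the space of all `(f, μ)`. -/
def actionForm (n : ℕ) (z : Target n) : Target n [⋀^Fin 1]→L[ℝ] ℝ :=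
  oneForm (∑ i, z.1 i • dμ n i)

end Toda

end

namespace Toda

/-! ### Monic polynomials with a three-term recurrence -/

/-- The monic polynomials with `p_0 = 1`, `p_1 = X - β_0` and
`p_{k+2} = (X - β_{k+1}) p_{k+1} - γ_k p_k`: the characteristic polynomials of the leading blocks
of a Jacobi matrix. -/
noncomputable def jacobiPoly (β γ : ℕ → ℝ) : ℕ → ℝ[X]
  | 0 => 1
  | 1 => X - C (β 0)
  | k + 2 => (X - C (β (k + 1))) * jacobiPoly β γ (k + 1) - C (γ k) * jacobiPoly β γ k

section Jacobi

variable {β γ : ℕ → ℝ}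

theorem jacobiPoly_add_two (k : ℕ) : jacobiPoly β γ (k + 2) =
    (X - C (β (k + 1))) * jacobiPoly β γ (k + 1) - C (γ k) * jacobiPoly β γ k := rfl

theorem jacobiPoly_natDegree_monic (β γ : ℕ → ℝ) (k : ℕ) :
    (jacobiPoly β γ k).natDegree = k ∧ (jacobiPoly β γ k).Monic := by
  induction k using Nat.twoStepInduction with
  | zero => simp [jacobiPoly]
  | one => simp [jacobiPoly, monic_X_sub_C]
  | more k h0 h1 =>
    have hm : ((X - C (β (k + 1))) * jacobiPoly β γ (k + 1)).Monic := (monic_X_sub_C _).mul h1.2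
    have hd : ((X - C (β (k + 1))) * jacobiPoly β γ (k + 1)).natDegree = k + 2 := by
      rw [(monic_X_sub_C _).natDegree_mul h1.2, h1.1, natDegree_X_sub_C]; omega
    have hlt : (C (γ k) * jacobiPoly β γ k).degree <
        ((X - C (β (k + 1))) * jacobiPoly β γ (k + 1)).degree := by
      apply degree_lt_degree
      rw [hd]
      have := natDegree_C_mul_le (γ k) (jacobiPoly β γ k)
      omega
    rw [jacobiPoly_add_two]
    refine ⟨?_, hm.sub_of_left hlt⟩
    rw [natDegree_sub_eq_left_of_natDegree_lt, hd]
    rw [hd]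
    have := natDegree_C_mul_le (γ k) (jacobiPoly β γ k)
    omega

theorem natDegree_jacobiPoly (k : ℕ) : (jacobiPoly β γ k).natDegree = k :=
  (jacobiPoly_natDegree_monic β γ k).1

theorem monic_jacobiPoly (k : ℕ) : (jacobiPoly β γ k).Monic :=
  (jacobiPoly_natDegree_monic β γ k).2

theorem degree_jacobiPoly (k : ℕ) : (jacobiPoly β γ k).degree = k := by
  rw [degree_eq_natDegree (monic_jacobiPoly k).ne_zero, natDegree_jacobiPoly]

/-- The confluent Christoffel–Darboux formula, as an inequality. -/
theorem jacobiPoly_wronskian_pos (hγ : ∀ k, 0 < γ k) (k : ℕ) (x : ℝ) :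
    0 < (derivative (jacobiPoly β γ (k + 1))).eval x * (jacobiPoly β γ k).eval x -
      (jacobiPoly β γ (k + 1)).eval x * (derivative (jacobiPoly β γ k)).eval x := by
  induction k with
  | zero => simp [jacobiPoly]
  | succ k ih =>
    have h := mul_pos (hγ k) ih
    have h2 := sq_nonneg ((jacobiPoly β γ (k + 1)).eval x)
    rw [jacobiPoly_add_two]
    simp only [derivative_sub, derivative_mul, derivative_X, derivative_C, eval_sub, eval_mul,
      eval_add, eval_X, eval_C, eval_one, eval_zero]
    nlinarith [h, h2]

theorem jacobiPoly_derivative_mul_pos (hγ : ∀ k, 0 < γ k) (k : ℕ) {x : ℝ}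
    (hx : (jacobiPoly β γ (k + 1)).eval x = 0) :
    0 < (derivative (jacobiPoly β γ (k + 1))).eval x * (jacobiPoly β γ k).eval x := by
  have := jacobiPoly_wronskian_pos (β := β) hγ k x
  rwa [hx, zero_mul, sub_zero] at this

theorem jacobiPoly_im_pos (hγ : ∀ k, 0 < γ k) (k : ℕ) {z : ℂ} (hz : z.im ≠ 0) :
    0 < z.im * (aeval z (jacobiPoly β γ (k + 1)) *
      (starRingEnd ℂ) (aeval z (jacobiPoly β γ k))).im := by
  induction k with
  | zero =>
    simp only [jacobiPoly, map_sub, aeval_X, aeval_C, map_one, mul_one, Complex.sub_im,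
      Complex.coe_algebraMap, Complex.ofReal_im, sub_zero]
    exact mul_self_pos.2 hz
  | succ k ih =>
    have h := mul_pos (hγ k) ih
    have hz2 := sq_nonneg (z.im)
    have h2 := mul_nonneg hz2 (Complex.normSq_nonneg (aeval z (jacobiPoly β γ (k + 1))))
    rw [Complex.normSq_apply] at h2
    rw [jacobiPoly_add_two]
    simp only [map_sub, map_mul, aeval_X, aeval_C, Complex.coe_algebraMap]
    simp only [Complex.mul_im, Complex.mul_re, Complex.sub_re, Complex.sub_im, Complex.ofReal_re,
      Complex.ofReal_im, Complex.conj_re, Complex.conj_im] at h ⊢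
    nlinarith [h, h2]

theorem jacobiPoly_splits (hγ : ∀ k, 0 < γ k) (k : ℕ) : (jacobiPoly β γ k).Splits := by
  rcases k with _ | k
  · simp [jacobiPoly]
  rw [splits_iff_splits]
  right
  intro g hg hdvd
  obtain ⟨z, hz⟩ := IsAlgClosed.exists_aeval_eq_zero ℂ g (degree_pos_of_irreducible hg).ne'
  have hz0 : aeval z (jacobiPoly β γ (k + 1)) = 0 := by
    obtain ⟨q, hq⟩ := hdvd
    rw [hq, map_mul, hz, zero_mul]
  have him : z.im = 0 := by
    by_contra h
    have := jacobiPoly_im_pos (β := β) hγ k h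
    simp [hz0] at this
  have hzr : z = algebraMap ℝ ℂ z.re := by
    apply Complex.ext <;> simp [him]
  rw [hzr, aeval_algebraMap_apply, map_eq_zero] at hz
  exact degree_eq_one_of_irreducible_of_root hg (x := z.re) (by simpa using hz)

theorem nodup_roots_jacobiPoly (hγ : ∀ k, 0 < γ k) (k : ℕ) : (jacobiPoly β γ k).roots.Nodup := by
  classical
  rcases k with _ | k
  · simp [jacobiPoly]
  rw [Multiset.nodup_iff_count_le_one]
  intro a
  rw [count_roots]
  by_contra! h
  rw [one_lt_rootMultiplicity_iff_isRoot (monic_jacobiPoly _).ne_zero] at h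
  have := jacobiPoly_derivative_mul_pos hγ k h.1
  rw [h.2.eq_zero, zero_mul] at this
  exact this.false

/-- The zeros of `p_k`. -/
noncomputable def jacobiRoots (β γ : ℕ → ℝ) (k : ℕ) : Finset ℝ :=
  (jacobiPoly β γ k).roots.toFinset

theorem mem_jacobiRoots {k : ℕ} {r : ℝ} :
    r ∈ jacobiRoots β γ k ↔ (jacobiPoly β γ k).eval r = 0 := by
  rw [jacobiRoots, Multiset.mem_toFinset, mem_roots (monic_jacobiPoly k).ne_zero, IsRoot]

theorem jacobiPoly_eq_nodal (hγ : ∀ k, 0 < γ k) (k : ℕ) :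
    jacobiPoly β γ k = Lagrange.nodal (jacobiRoots β γ k) id := by
  rw [(jacobiPoly_splits hγ k).eq_prod_roots, (monic_jacobiPoly k).leadingCoeff, C_1, one_mul,
    Lagrange.nodal, jacobiRoots, Finset.prod, Multiset.toFinset_val,
    (nodup_roots_jacobiPoly hγ k).dedup]
  rfl

theorem card_jacobiRoots (hγ : ∀ k, 0 < γ k) (k : ℕ) : (jacobiRoots β γ k).card = k := by
  have := congrArg natDegree (jacobiPoly_eq_nodal (β := β) hγ k)
  rw [Lagrange.natDegree_nodal, natDegree_jacobiPoly] at this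
  exact this.symm

end Jacobi

/-- The sum of the residues of `q / ∏ (X - r)` is the coefficient of `q` in the top degree. -/
theorem sum_eval_div_derivative_nodal (s : Finset ℝ) {q : ℝ[X]} (hq : q.degree < s.card) :
    ∑ r ∈ s, q.eval r / (derivative (Lagrange.nodal s id)).eval r = q.coeff (s.card - 1) := by
  classical
  rw [Lagrange.coeff_eq_sum (v := id) (s := s) (Set.injOn_id _) hq]
  refine Finset.sum_congr rfl fun r hr => ?_
  have := Lagrange.eval_nodal_derivative_eval_node_eq (v := (id : ℝ → ℝ)) hr
  simp only [id] at this ⊢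
  rw [this, Lagrange.eval_nodal]
  rfl

/-! ### First variations of the polynomials and the residue recursion -/

/-- The derivative of `jacobiPoly β γ k` along given variations of `β` and `γ`. -/
noncomputable def jacobiVar (β γ β' γ' : ℕ → ℝ) : ℕ → ℝ[X]
  | 0 => 0
  | 1 => -C (β' 0)
  | k + 2 => (X - C (β (k + 1))) * jacobiVar β γ β' γ' (k + 1)
      - C (β' (k + 1)) * jacobiPoly β γ (k + 1)
      - C (γ k) * jacobiVar β γ β' γ' k - C (γ' k) * jacobiPoly β γ k

theorem jacobiVar_add_two (β γ β' γ' : ℕ → ℝ) (k : ℕ) : jacobiVar β γ β' γ' (k + 2) =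
    (X - C (β (k + 1))) * jacobiVar β γ β' γ' (k + 1)
      - C (β' (k + 1)) * jacobiPoly β γ (k + 1)
      - C (γ k) * jacobiVar β γ β' γ' k - C (γ' k) * jacobiPoly β γ k := rfl

theorem hasDerivAt_eval_jacobiPoly {β γ : ℝ → ℕ → ℝ} {β' γ' : ℕ → ℝ} {l : ℝ → ℝ} {l' t : ℝ}
    (hβ : ∀ k, HasDerivAt (fun s => β s k) (β' k) t)
    (hγ : ∀ k, HasDerivAt (fun s => γ s k) (γ' k) t) (hl : HasDerivAt l l' t) (k : ℕ) :
    HasDerivAt (fun s => (jacobiPoly (β s) (γ s) k).eval (l s))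
      ((jacobiVar (β t) (γ t) β' γ' k).eval (l t) +
        (derivative (jacobiPoly (β t) (γ t) k)).eval (l t) * l') t := by
  induction k using Nat.twoStepInduction with
  | zero => simpa [jacobiPoly, jacobiVar] using hasDerivAt_const t (1 : ℝ)
  | one =>
    simp only [jacobiPoly, jacobiVar, eval_sub, eval_X, eval_C, eval_neg, derivative_sub,
      derivative_X, derivative_C, eval_one, sub_zero, one_mul]
    exact (hl.sub (hβ 0)).congr_deriv (by ring)
  | more k h0 h1 =>
    simp only [jacobiPoly_add_two, jacobiVar_add_two, eval_sub, eval_mul, eval_X, eval_C,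
      derivative_sub, derivative_mul, derivative_X, derivative_C, eval_add, eval_one, sub_zero,
      eval_zero]
    exact (((hl.sub (hβ (k + 1))).mul h1).sub ((hγ k).mul h0)).congr_deriv (by
      simp only [Pi.sub_apply]; ring)

section Variation

variable {β γ : ℕ → ℝ} {β' γ' : ℕ → ℝ}

theorem degree_jacobiVar_lt (k : ℕ) : (jacobiVar β γ β' γ' k).degree < k := by
  induction k using Nat.twoStepInduction with
  | zero => simp [jacobiVar]
  | one =>
    rw [jacobiVar, degree_neg]
    exact degree_C_lt
  | more k h0 h1 =>
    have hC : ∀ (a : ℝ) (p : ℝ[X]), (C a * p).degree ≤ p.degree := fun a p => by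
      rw [degree_mul]
      exact (add_le_add degree_C_le le_rfl).trans (by simp)
    have hk : ((k : ℕ) : WithBot ℕ) < ((k + 2 : ℕ) : WithBot ℕ) := by exact_mod_cast (by omega)
    have hk1 : ((k + 1 : ℕ) : WithBot ℕ) < ((k + 2 : ℕ) : WithBot ℕ) := by
      exact_mod_cast (by omega)
    rw [jacobiVar_add_two]
    refine (degree_sub_le _ _).trans_lt (max_lt ((degree_sub_le _ _).trans_lt (max_lt
      ((degree_sub_le _ _).trans_lt (max_lt ?_ ?_)) ?_)) ?_)
    · rw [degree_mul, degree_X_sub_C, add_comm]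
      by_cases h : jacobiVar β γ β' γ' (k + 1) = 0
      · simp only [h, degree_zero, WithBot.bot_add]
        exact WithBot.bot_lt_coe _
      · rw [degree_eq_natDegree h] at h1 ⊢
        have : (jacobiVar β γ β' γ' (k + 1)).natDegree < k + 1 := by exact_mod_cast h1
        exact_mod_cast (by omega : (jacobiVar β γ β' γ' (k + 1)).natDegree + 1 < k + 2)
    · exact (hC _ _).trans_lt (by rw [degree_jacobiPoly]; exact hk1)
    · exact (hC _ _).trans_lt (h0.trans hk)
    · exact (hC _ _).trans_lt (by rw [degree_jacobiPoly]; exact hk)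

theorem coeff_jacobiVar (k : ℕ) :
    (jacobiVar β γ β' γ' (k + 1)).coeff k = -∑ j ∈ Finset.range (k + 1), β' j := by
  induction k with
  | zero => simp [jacobiVar]
  | succ k ih =>
    have h0 : (jacobiVar β γ β' γ' k).coeff (k + 1) = 0 :=
      coeff_eq_zero_of_degree_lt ((degree_jacobiVar_lt k).trans (by exact_mod_cast k.lt_succ_self))
    have h1 : (jacobiVar β γ β' γ' (k + 1)).coeff (k + 1) = 0 :=
      coeff_eq_zero_of_degree_lt (degree_jacobiVar_lt (k + 1))
    have h2 : (jacobiPoly β γ k).coeff (k + 1) = 0 :=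
      coeff_eq_zero_of_natDegree_lt (by rw [natDegree_jacobiPoly]; omega)
    have h3 : (jacobiPoly β γ (k + 1)).coeff (k + 1) = 1 := by
      have := (monic_jacobiPoly (β := β) (γ := γ) (k + 1)).coeff_natDegree
      rwa [natDegree_jacobiPoly] at this
    rw [jacobiVar_add_two, Finset.sum_range_succ]
    simp only [sub_mul, coeff_sub, coeff_X_mul, coeff_C_mul, h0, h1, h2, h3, ih]
    ring

end Variation

section Residue

variable {β γ β₁ γ₁ β₂ γ₂ : ℕ → ℝ}

/-- The residue sum that evaluates `∑ dμ_i ∧ d log |p_k(μ_i)|`, up to sign, at the zeros `μ_i` of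
`p_{k+1}`. -/
noncomputable def residueSum (β γ β₁ γ₁ β₂ γ₂ : ℕ → ℝ) (k : ℕ) : ℝ :=
  ∑ r ∈ jacobiRoots β γ (k + 1),
    ((jacobiVar β γ β₁ γ₁ (k + 1)).eval r * (jacobiVar β γ β₂ γ₂ k).eval r -
      (jacobiVar β γ β₂ γ₂ (k + 1)).eval r * (jacobiVar β γ β₁ γ₁ k).eval r) /
    ((derivative (jacobiPoly β γ (k + 1))).eval r * (jacobiPoly β γ k).eval r)

theorem residueSum_zero : residueSum β γ β₁ γ₁ β₂ γ₂ 0 = 0 := by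
  simp [residueSum, jacobiVar]

theorem sum_jacobiVar_div (hγ : ∀ k, 0 < γ k) (k : ℕ) :
    ∑ r ∈ jacobiRoots β γ (k + 1), (jacobiVar β γ β₁ γ₁ (k + 1)).eval r /
      (derivative (jacobiPoly β γ (k + 1))).eval r = -∑ j ∈ Finset.range (k + 1), β₁ j := by
  have := sum_eval_div_derivative_nodal (jacobiRoots β γ (k + 1))
    (q := jacobiVar β γ β₁ γ₁ (k + 1)) (by
      rw [card_jacobiRoots hγ]; exact degree_jacobiVar_lt (k + 1))
  rw [← jacobiPoly_eq_nodal hγ, card_jacobiRoots hγ, Nat.add_sub_cancel, coeff_jacobiVar] at this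
  exact this

/-- The residue theorem for `w / (p_{k+1} p_k)`, when this decays fast enough at infinity. -/
theorem sum_residues_eq_zero (hγ : ∀ k, 0 < γ k) (k : ℕ) {w : ℝ[X]}
    (hw : w.degree < (k + 1 + (k + 1) : ℕ)) :
    ∑ r ∈ jacobiRoots β γ (k + 2), w.eval r /
        ((derivative (jacobiPoly β γ (k + 2))).eval r * (jacobiPoly β γ (k + 1)).eval r) +
      ∑ r ∈ jacobiRoots β γ (k + 1), w.eval r /
        ((jacobiPoly β γ (k + 2)).eval r * (derivative (jacobiPoly β γ (k + 1))).eval r) = 0 := by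
  classical
  have hdisj : Disjoint (jacobiRoots β γ (k + 2)) (jacobiRoots β γ (k + 1)) := by
    rw [Finset.disjoint_left]
    intro r h2 h1
    rw [mem_jacobiRoots] at h1 h2
    have := jacobiPoly_derivative_mul_pos hγ (k + 1) h2
    rw [h1, mul_zero] at this
    exact this.false
  have hcard : (jacobiRoots β γ (k + 2) ∪ jacobiRoots β γ (k + 1)).card = k + 2 + (k + 1) := by
    rw [Finset.card_union_of_disjoint hdisj, card_jacobiRoots hγ, card_jacobiRoots hγ]
  have hnodal : Lagrange.nodal (jacobiRoots β γ (k + 2) ∪ jacobiRoots β γ (k + 1)) id =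
      jacobiPoly β γ (k + 2) * jacobiPoly β γ (k + 1) := by
    rw [jacobiPoly_eq_nodal hγ (k + 2), jacobiPoly_eq_nodal hγ (k + 1), Lagrange.nodal,
      Finset.prod_union hdisj]
    rfl
  have key := sum_eval_div_derivative_nodal
    (jacobiRoots β γ (k + 2) ∪ jacobiRoots β γ (k + 1)) (q := w)
    (hw.trans (by rw [hcard]; exact_mod_cast (by omega)))
  rw [hcard, coeff_eq_zero_of_degree_lt (hw.trans_le (Nat.cast_le.2 (by omega))), hnodal,
    Finset.sum_union hdisj] at key
  rw [← key]
  congr 1 <;> refine Finset.sum_congr rfl fun r hr => ?_ <;> rw [mem_jacobiRoots] at hr <;>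
    simp [derivative_mul, hr]

theorem residueSum_succ (hγ : ∀ k, 0 < γ k) (k : ℕ) :
    residueSum β γ β₁ γ₁ β₂ γ₂ (k + 1) = residueSum β γ β₁ γ₁ β₂ γ₂ k +
      (γ₁ k / γ k * ∑ j ∈ Finset.range (k + 1), β₂ j -
        γ₂ k / γ k * ∑ j ∈ Finset.range (k + 1), β₁ j) := by
  set w : ℝ[X] := jacobiVar β γ β₁ γ₁ (k + 2) * jacobiVar β γ β₂ γ₂ (k + 1) -
    jacobiVar β γ β₂ γ₂ (k + 2) * jacobiVar β γ β₁ γ₁ (k + 1) with hw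
  have hmul : ∀ p q : ℝ[X], p.degree < (k + 2 : ℕ) → q.degree < (k + 1 : ℕ) →
      (p * q).degree < (k + 1 + (k + 1) : ℕ) := by
    intro p q hp hq
    by_cases hp0 : p = 0
    · simp only [hp0, zero_mul, degree_zero]; exact WithBot.bot_lt_coe _
    by_cases hq0 : q = 0
    · simp only [hq0, mul_zero, degree_zero]; exact WithBot.bot_lt_coe _
    rw [degree_mul, degree_eq_natDegree hp0, degree_eq_natDegree hq0]
    rw [degree_eq_natDegree hp0] at hp
    rw [degree_eq_natDegree hq0] at hq
    have h1 : p.natDegree < k + 2 := by exact_mod_cast hp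
    have h2 : q.natDegree < k + 1 := by exact_mod_cast hq
    exact_mod_cast (by omega : p.natDegree + q.natDegree < k + 1 + (k + 1))
  have hdeg : w.degree < (k + 1 + (k + 1) : ℕ) :=
    (degree_sub_le _ _).trans_lt (max_lt
      (hmul _ _ (degree_jacobiVar_lt _) (degree_jacobiVar_lt _))
      (hmul _ _ (degree_jacobiVar_lt _) (degree_jacobiVar_lt _)))
  have key := sum_residues_eq_zero (β := β) hγ k (w := w) hdeg
  have h1 : residueSum β γ β₁ γ₁ β₂ γ₂ (k + 1) = ∑ r ∈ jacobiRoots β γ (k + 2), w.eval r /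
        ((derivative (jacobiPoly β γ (k + 2))).eval r * (jacobiPoly β γ (k + 1)).eval r) := by
    simp only [residueSum, hw, eval_sub, eval_mul]
  have h2 : ∑ r ∈ jacobiRoots β γ (k + 1), w.eval r /
        ((jacobiPoly β γ (k + 2)).eval r * (derivative (jacobiPoly β γ (k + 1))).eval r) =
      -residueSum β γ β₁ γ₁ β₂ γ₂ k +
        (γ₁ k / γ k * ∑ r ∈ jacobiRoots β γ (k + 1), (jacobiVar β γ β₂ γ₂ (k + 1)).eval r /
            (derivative (jacobiPoly β γ (k + 1))).eval r -
          γ₂ k / γ k * ∑ r ∈ jacobiRoots β γ (k + 1), (jacobiVar β γ β₁ γ₁ (k + 1)).eval r /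
            (derivative (jacobiPoly β γ (k + 1))).eval r) := by
    rw [residueSum, Finset.mul_sum, Finset.mul_sum, ← Finset.sum_neg_distrib,
      ← Finset.sum_sub_distrib, ← Finset.sum_add_distrib]
    refine Finset.sum_congr rfl fun r hr => ?_
    rw [mem_jacobiRoots] at hr
    have hpos := jacobiPoly_derivative_mul_pos hγ k hr
    have hd := left_ne_zero_of_mul hpos.ne'
    have hq := right_ne_zero_of_mul hpos.ne'
    have hg := (hγ k).ne'
    simp only [hw, jacobiVar_add_two, jacobiPoly_add_two, eval_sub, eval_mul, eval_X, eval_C, hr]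
    field_simp
    ring
  rw [h2, sum_jacobiVar_div hγ, sum_jacobiVar_div hγ] at key
  rw [h1]
  linarith

theorem residueSum_eq (hγ : ∀ k, 0 < γ k) (k : ℕ) :
    residueSum β γ β₁ γ₁ β₂ γ₂ k = ∑ i ∈ Finset.range k,
      (γ₁ i / γ i * ∑ j ∈ Finset.range (i + 1), β₂ j -
        γ₂ i / γ i * ∑ j ∈ Finset.range (i + 1), β₁ j) := by
  induction k with
  | zero => simp [residueSum_zero]
  | succ k ih => rw [residueSum_succ hγ, ih, ← Finset.sum_range_succ (fun i => _ - _)]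

end Residue

/-! ### The Dirichlet eigenvalues as zeros of `p_{n-1}` -/

section Dirichlet

variable {n : ℕ}

/-- The diagonal entries `b_2, b_3, …`. -/
def diag (x : Flaschka n) (k : ℕ) : ℝ := x.1 ((k + 2 : ℕ) : ZMod n)

/-- The squares of the off-diagonal entries `a_2, a_3, …`. -/
def offDiagSq (x : Flaschka n) (k : ℕ) : ℝ := x.2 ((k + 2 : ℕ) : ZMod n) ^ 2

/-- The characteristic polynomial of the Jacobi matrix with diagonal `b_2, …, b_{k+1}`. -/
noncomputable def charPoly (x : Flaschka n) (k : ℕ) : ℝ[X] := jacobiPoly (diag x) (offDiagSq x) k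

/-- The open set of all `(b, a)` with positive `a`. -/
def positiveRegion (n : ℕ) : Set (Flaschka n) := {x | ∀ i, 0 < x.2 i}

theorem isOpen_positiveRegion (n : ℕ) [NeZero n] : IsOpen (positiveRegion n) := by
  rw [positiveRegion, Set.ofPred_forall]
  exact isOpen_iInter_of_finite fun i =>
    isOpen_lt continuous_const ((continuous_apply i).comp continuous_snd)

theorem phaseSpace_subset (n : ℕ) [NeZero n] (α : ℝ) : phaseSpace n α ⊆ positiveRegion n :=
  fun _ hx => hx.1

variable {x : Flaschka n}

theorem offDiagSq_pos (hx : x ∈ positiveRegion n) (k : ℕ) : 0 < offDiagSq x k :=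
  pow_pos (hx _) 2

/-- The product `a_1 ⋯ a_k`. -/
noncomputable def prodA (x : Flaschka n) (k : ℕ) : ℝ :=
  ∏ j ∈ Finset.range k, x.2 ((j + 1 : ℕ) : ZMod n)

theorem prodA_pos (hx : x ∈ positiveRegion n) (k : ℕ) : 0 < prodA x k :=
  Finset.prod_pos fun _ _ => hx _

theorem y₁_eq (hx : x ∈ positiveRegion n) (k : ℕ) :
    y₁ x (k + 2) = C (-(x.2 0 / prodA x (k + 1))) * charPoly x k := by
  induction k using Nat.twoStepInduction with
  | zero =>
    rw [y₁, solution, solution, solution, charPoly, jacobiPoly, prodA, Finset.prod_range_one]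
    simp only [C_0, mul_zero, zero_sub, C_1, mul_one, Nat.cast_zero, zero_add]
    rw [mul_neg, ← C_mul, ← C_neg]
    congr 1; ring
  | one =>
    have h2 := (hx ((1 + 1 : ℕ) : ZMod n)).ne'
    have h1 := (hx ((0 + 1 : ℕ) : ZMod n)).ne'
    apply Polynomial.funext
    intro t
    simp only [y₁, solution, charPoly, jacobiPoly, prodA, Finset.prod_range_succ,
      Finset.prod_range_zero, diag, eval_mul, eval_sub, eval_C, eval_X, one_mul, Nat.cast_zero]
    field_simp
    ring
  | more k h0 h1 =>
    have e : y₁ x (k + 2 + 2) = C (x.2 ((k + 3 : ℕ) : ZMod n))⁻¹ *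
      ((X - C (x.1 ((k + 3 : ℕ) : ZMod n))) * y₁ x (k + 1 + 2)
        - C (x.2 ((k + 2 : ℕ) : ZMod n)) * y₁ x (k + 2)) := rfl
    have h3 := (hx ((k + 3 : ℕ) : ZMod n)).ne'
    have h2 := (hx ((k + 2 : ℕ) : ZMod n)).ne'
    have hp := (prodA_pos hx (k + 1)).ne'
    have p2 : prodA x (k + 2) = prodA x (k + 1) * x.2 ((k + 2 : ℕ) : ZMod n) :=
      Finset.prod_range_succ _ _
    have p3 : prodA x (k + 3) = prodA x (k + 2) * x.2 ((k + 3 : ℕ) : ZMod n) :=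
      Finset.prod_range_succ _ _
    rw [e, h0, h1, charPoly, charPoly, charPoly, jacobiPoly_add_two, diag, offDiagSq]
    apply Polynomial.funext
    intro t
    simp only [eval_mul, eval_sub, eval_C, eval_X]
    rw [show k + 2 + 1 = k + 3 from rfl, show k + 1 + 1 = k + 2 from rfl,
      show k + 1 + 2 = k + 3 from rfl, p3, p2]
    field_simp
    ring

theorem wronskian_eq (hx : x ∈ positiveRegion n) (t : ℝ) (k : ℕ) :
    x.2 (k : ZMod n) * ((y₁ x k).eval t * (y₂ x (k + 1)).eval t -
      (y₁ x (k + 1)).eval t * (y₂ x k).eval t) = x.2 0 := by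
  induction k with
  | zero => simp [y₁, y₂, solution]
  | succ k ih =>
    have h1 := (hx ((k + 1 : ℕ) : ZMod n)).ne'
    rw [← ih, y₁, y₂, y₁, y₂, solution, solution]
    simp only [y₁, y₂, eval_mul, eval_sub, eval_C, eval_X]
    field_simp
    ring

theorem y₁_coeff_ne_zero (hx : x ∈ positiveRegion n) : -(x.2 0 / prodA x (n - 1 + 1)) ≠ 0 :=
  neg_ne_zero.2 (div_pos (hx 0) (prodA_pos hx _)).ne'

variable [NeZero n]

theorem y₁_succ_eq (hx : x ∈ positiveRegion n) :
    y₁ x (n + 1) = C (-(x.2 0 / prodA x (n - 1 + 1))) * charPoly x (n - 1) := by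
  have := NeZero.one_le (n := n)
  rw [← y₁_eq hx, show n - 1 + 2 = n + 1 by omega]

theorem roots_y₁_succ (hx : x ∈ positiveRegion n) :
    (y₁ x (n + 1)).roots = (charPoly x (n - 1)).roots := by
  rw [y₁_succ_eq hx, roots_C_mul _ (y₁_coeff_ne_zero hx)]

theorem natDegree_y₁_succ (hx : x ∈ positiveRegion n) : (y₁ x (n + 1)).natDegree = n - 1 := by
  rw [y₁_succ_eq hx, natDegree_C_mul (y₁_coeff_ne_zero hx), charPoly, natDegree_jacobiPoly]

theorem length_sort_roots (hx : x ∈ positiveRegion n) :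
    ((y₁ x (n + 1)).roots.sort (fun s t => s ≤ t)).length = n - 1 := by
  rw [Multiset.length_sort, roots_y₁_succ hx, charPoly,
    ← (jacobiPoly_splits (offDiagSq_pos hx) (n - 1)).natDegree_eq_card_roots, natDegree_jacobiPoly]

theorem dirichlet_eq_getElem (hx : x ∈ positiveRegion n) (i : Fin (n - 1)) :
    dirichlet x i = ((y₁ x (n + 1)).roots.sort (fun s t => s ≤ t))[i.val]'(by
      rw [length_sort_roots hx]; exact i.2) := by
  rw [dirichlet, List.getD_eq_getElem]

theorem roots_eq_map_dirichlet (hx : x ∈ positiveRegion n) :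
    (y₁ x (n + 1)).roots = Finset.univ.val.map (dirichlet x) := by
  have h : (y₁ x (n + 1)).roots.sort (fun s t => s ≤ t) = List.ofFn (dirichlet x) := by
    apply List.ext_getElem
    · rw [length_sort_roots hx, List.length_ofFn]
    · intro i h1 h2
      rw [List.getElem_ofFn, dirichlet_eq_getElem hx]
  conv_lhs => rw [← Multiset.sort_eq (y₁ x (n + 1)).roots (fun s t => s ≤ t), h]
  simp [Fin.univ_val_map]

theorem dirichlet_strictMono (hx : x ∈ positiveRegion n) : StrictMono (dirichlet x) := by
  intro i j hij
  rw [dirichlet_eq_getElem hx, dirichlet_eq_getElem hx]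
  have hs := (y₁ x (n + 1)).roots.pairwise_sort (fun s t => s ≤ t)
  have hn : ((y₁ x (n + 1)).roots.sort (fun s t => s ≤ t)).Nodup := by
    rw [← Multiset.coe_nodup, Multiset.sort_eq, roots_y₁_succ hx]
    exact nodup_roots_jacobiPoly (offDiagSq_pos hx) _
  refine lt_of_le_of_ne (List.pairwise_iff_getElem.1 hs _ _ _ _ hij) fun h => ?_
  exact hij.ne (Fin.ext ((hn.getElem_inj_iff).1 h))

theorem eval_charPoly_dirichlet (hx : x ∈ positiveRegion n) (i : Fin (n - 1)) :
    (charPoly x (n - 1)).eval (dirichlet x i) = 0 := by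
  have : dirichlet x i ∈ (charPoly x (n - 1)).roots := by
    rw [← roots_y₁_succ hx, roots_eq_map_dirichlet hx]
    exact Multiset.mem_map_of_mem _ (Finset.mem_univ_val i)
  exact (mem_roots'.1 this).2

theorem jacobiRoots_eq_image (hx : x ∈ positiveRegion n) :
    jacobiRoots (diag x) (offDiagSq x) (n - 1) = Finset.univ.image (dirichlet x) := by
  classical
  ext r
  rw [jacobiRoots, ← charPoly, Multiset.mem_toFinset, ← roots_y₁_succ hx,
    roots_eq_map_dirichlet hx]
  simp

theorem dirichlet_eq_of_eval_eq_zero (hx : x ∈ positiveRegion n) {μ : Fin (n - 1) → ℝ}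
    (hμ : StrictMono μ) (h0 : ∀ i, (charPoly x (n - 1)).eval (μ i) = 0) : dirichlet x = μ := by
  classical
  refine ((dirichlet_strictMono hx).range_inj hμ).1 ?_
  have hsub : Finset.univ.image μ ⊆ Finset.univ.image (dirichlet x) := by
    rw [← jacobiRoots_eq_image hx]
    intro r hr
    obtain ⟨i, -, rfl⟩ := Finset.mem_image.1 hr
    exact mem_jacobiRoots.2 (h0 i)
  have heq := Finset.eq_of_subset_of_card_le hsub (by
    rw [Finset.card_image_of_injective _ (dirichlet_strictMono hx).injective,
      Finset.card_image_of_injective _ hμ.injective])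
  have := congrArg (fun s : Finset ℝ => (s : Set ℝ)) heq
  simpa using this.symm

theorem charPoly_eq_prod (hx : x ∈ positiveRegion n) :
    charPoly x (n - 1) = ∏ i, (X - C (dirichlet x i)) := by
  classical
  rw [charPoly, jacobiPoly_eq_nodal (offDiagSq_pos hx), jacobiRoots_eq_image hx, Lagrange.nodal,
    Finset.prod_image (dirichlet_strictMono hx).injective.injOn]
  rfl

theorem eval_y₁_mul_y₂ (hx : x ∈ positiveRegion n) (i : Fin (n - 1)) :
    (y₁ x n).eval (dirichlet x i) * (y₂ x (n + 1)).eval (dirichlet x i) = 1 := by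
  have h := wronskian_eq hx (dirichlet x i) n
  rw [y₁_succ_eq hx, eval_mul, eval_charPoly_dirichlet hx, mul_zero, zero_mul, sub_zero,
    ZMod.natCast_self] at h
  exact mul_left_cancel₀ (hx 0).ne' (h.trans (mul_one _).symm)

end Dirichlet

/-! ### Orthogonal polynomials of a finitely supported measure -/

section Ortho

variable {m : ℕ}

/-- Integration against the measure with mass `w i` at `μ i`. -/
noncomputable def moment (w μ : Fin m → ℝ) (q : ℝ[X]) : ℝ := ∑ i, w i * q.eval (μ i)

theorem moment_add (w μ : Fin m → ℝ) (p q : ℝ[X]) :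
    moment w μ (p + q) = moment w μ p + moment w μ q := by
  simp [moment, mul_add, Finset.sum_add_distrib]

theorem moment_sub (w μ : Fin m → ℝ) (p q : ℝ[X]) :
    moment w μ (p - q) = moment w μ p - moment w μ q := by
  simp [moment, mul_sub, Finset.sum_sub_distrib]

theorem moment_C_mul (w μ : Fin m → ℝ) (a : ℝ) (q : ℝ[X]) :
    moment w μ (C a * q) = a * moment w μ q := by
  simp only [moment, eval_mul, eval_C, Finset.mul_sum]
  exact Finset.sum_congr rfl fun i _ => by ring

theorem moment_sq_pos {w μ : Fin m → ℝ} (hw : ∀ i, 0 < w i) (hμ : Function.Injective μ)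
    {q : ℝ[X]} (hq : q ≠ 0) (hdeg : q.natDegree < m) : 0 < moment w μ (q * q) := by
  have hnn : ∀ i ∈ Finset.univ, 0 ≤ w i * (q * q).eval (μ i) := fun i _ => by
    rw [eval_mul]; exact mul_nonneg (hw i).le (mul_self_nonneg _)
  refine (Finset.sum_nonneg hnn).lt_of_ne fun h => hq ?_
  have h0 := (Finset.sum_eq_zero_iff_of_nonneg hnn).1 h.symm
  refine eq_zero_of_natDegree_lt_card_of_eval_eq_zero q hμ (fun i => ?_) (by simpa using hdeg)
  have := h0 i (Finset.mem_univ i)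
  rw [eval_mul] at this
  exact mul_self_eq_zero.1 ((mul_eq_zero.1 this).resolve_left (hw i).ne')

theorem moment_mul_nodal_erase (w μ : Fin m → ℝ) (p : ℝ[X]) (i : Fin m) :
    moment w μ (p * Lagrange.nodal (Finset.univ.erase i) μ) =
      w i * (p.eval (μ i) * ∏ j ∈ Finset.univ.erase i, (μ i - μ j)) := by
  rw [moment, Finset.sum_eq_single i]
  · rw [eval_mul, Lagrange.eval_nodal]
  · intro j _ hj
    rw [eval_mul, Lagrange.eval_nodal_at_node (Finset.mem_erase.2 ⟨hj, Finset.mem_univ j⟩),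
      mul_zero, mul_zero]
  · simp

/-- Consecutive monic orthogonal polynomials `(p_k, p_{k-1})`, by the Gram–Schmidt process. -/
noncomputable def orthoPair (w μ : Fin m → ℝ) : ℕ → ℝ[X] × ℝ[X]
  | 0 => (1, 0)
  | k + 1 =>
    ((X - C (moment w μ (X * (orthoPair w μ k).1 * (orthoPair w μ k).1) /
          moment w μ ((orthoPair w μ k).1 * (orthoPair w μ k).1))) * (orthoPair w μ k).1 -
        C (moment w μ ((orthoPair w μ k).1 * (orthoPair w μ k).1) /
          moment w μ ((orthoPair w μ k).2 * (orthoPair w μ k).2)) * (orthoPair w μ k).2,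
      (orthoPair w μ k).1)

/-- The monic orthogonal polynomials. -/
noncomputable def orthoPoly (w μ : Fin m → ℝ) (k : ℕ) : ℝ[X] := (orthoPair w μ k).1

/-- The squared norms of the orthogonal polynomials. -/
noncomputable def orthoNorm (w μ : Fin m → ℝ) (k : ℕ) : ℝ :=
  moment w μ (orthoPoly w μ k * orthoPoly w μ k)

/-- The diagonal recurrence coefficients. -/
noncomputable def orthoDiag (w μ : Fin m → ℝ) (k : ℕ) : ℝ :=
  moment w μ (X * orthoPoly w μ k * orthoPoly w μ k) / orthoNorm w μ k

/-- The off-diagonal recurrence coefficients. -/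
noncomputable def orthoOff (w μ : Fin m → ℝ) (k : ℕ) : ℝ :=
  orthoNorm w μ (k + 1) / orthoNorm w μ k

theorem orthoPoly_add_two (w μ : Fin m → ℝ) (k : ℕ) : orthoPoly w μ (k + 2) =
    (X - C (orthoDiag w μ (k + 1))) * orthoPoly w μ (k + 1) -
      C (orthoOff w μ k) * orthoPoly w μ k := rfl

theorem orthoPoly_one (w μ : Fin m → ℝ) : orthoPoly w μ 1 = X - C (orthoDiag w μ 0) := by
  have : orthoPoly w μ 1 = (X - C (orthoDiag w μ 0)) * 1 - C (orthoNorm w μ 0 /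
    moment w μ (0 * 0)) * 0 := rfl
  rw [this, mul_one, mul_zero, sub_zero]

theorem orthoPoly_eq_jacobiPoly (w μ : Fin m → ℝ) (k : ℕ) :
    orthoPoly w μ k = jacobiPoly (orthoDiag w μ) (orthoOff w μ) k := by
  induction k using Nat.twoStepInduction with
  | zero => rfl
  | one => rw [orthoPoly_one, jacobiPoly]
  | more k h0 h1 => rw [orthoPoly_add_two, h0, h1, jacobiPoly_add_two]

theorem natDegree_orthoPoly (w μ : Fin m → ℝ) (k : ℕ) : (orthoPoly w μ k).natDegree = k := by
  rw [orthoPoly_eq_jacobiPoly, natDegree_jacobiPoly]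

theorem monic_orthoPoly (w μ : Fin m → ℝ) (k : ℕ) : (orthoPoly w μ k).Monic := by
  rw [orthoPoly_eq_jacobiPoly]; exact monic_jacobiPoly k

theorem coeff_orthoPoly (w μ : Fin m → ℝ) (k : ℕ) : (orthoPoly w μ k).coeff k = 1 := by
  have := (monic_orthoPoly w μ k).coeff_natDegree
  rwa [natDegree_orthoPoly] at this

section Positive

variable {w μ : Fin m → ℝ}

theorem orthoNorm_pos (hw : ∀ i, 0 < w i) (hμ : Function.Injective μ) {k : ℕ}
    (hk : k < m) : 0 < orthoNorm w μ k :=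
  moment_sq_pos hw hμ (monic_orthoPoly w μ k).ne_zero (by rwa [natDegree_orthoPoly])

theorem orthoOff_pos (hw : ∀ i, 0 < w i) (hμ : Function.Injective μ) {k : ℕ}
    (hk : k + 1 < m) : 0 < orthoOff w μ k :=
  div_pos (orthoNorm_pos hw hμ hk) (orthoNorm_pos hw hμ (by omega))

/-- Orthogonality: pairing with `p_k` extracts the coefficient of degree `k`. -/
theorem moment_orthoPoly_mul (hw : ∀ i, 0 < w i) (hμ : Function.Injective μ)
    (k : ℕ) (hk : k ≤ m) (q : ℝ[X]) (hq : q.natDegree ≤ k) :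
    moment w μ (orthoPoly w μ k * q) = orthoNorm w μ k * q.coeff k := by
  induction k using Nat.twoStepInduction generalizing q with
  | zero =>
    rw [eq_C_of_natDegree_le_zero hq, coeff_C_zero, mul_comm (orthoPoly w μ 0), moment_C_mul,
      orthoNorm, show orthoPoly w μ 0 = 1 from rfl, mul_one, mul_comm]
  | one =>
    have h0 := (orthoNorm_pos hw hμ (k := 0) (by omega)).ne'
    obtain ⟨r, hr⟩ : ∃ r, q = C (q.coeff 1) * orthoPoly w μ 1 + C r := by
      refine ⟨q.coeff 0 + q.coeff 1 * orthoDiag w μ 0, ?_⟩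
      conv_lhs => rw [eq_X_add_C_of_natDegree_le_one hq]
      rw [orthoPoly_one, C_add, C_mul]; ring
    have hone : moment w μ (orthoPoly w μ 1) = 0 := by
      rw [orthoPoly_one, moment_sub, ← mul_one (C _), moment_C_mul, orthoDiag]
      have : orthoNorm w μ 0 = moment w μ 1 := by
        rw [orthoNorm, show orthoPoly w μ 0 = 1 from rfl, mul_one]
      rw [← this, div_mul_cancel₀ _ h0, show orthoPoly w μ 0 = 1 from rfl, mul_one, mul_one, sub_self]
    conv_lhs => rw [hr, mul_add, moment_add, mul_left_comm, moment_C_mul, mul_comm _ (C r),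
      moment_C_mul, hone]
    rw [orthoNorm]; ring
  | more k ih0 ih1 =>
    have h0 := (orthoNorm_pos hw hμ (k := k) (by omega)).ne'
    have h1 := (orthoNorm_pos hw hμ (k := k + 1) (by omega)).ne'
    have hlow : ∀ r : ℝ[X], r.natDegree ≤ k → moment w μ (orthoPoly w μ (k + 2) * r) = 0 := by
      intro r hr
      have hX : (X * r).natDegree ≤ k + 1 := by
        refine natDegree_mul_le.trans ?_
        rw [natDegree_X]; omega
      have e : orthoPoly w μ (k + 2) * r = orthoPoly w μ (k + 1) * (X * r) -
          C (orthoDiag w μ (k + 1)) * (orthoPoly w μ (k + 1) * r) -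
          C (orthoOff w μ k) * (orthoPoly w μ k * r) := by
        rw [orthoPoly_add_two]; ring
      rw [e, moment_sub, moment_sub, moment_C_mul, moment_C_mul, ih1 (by omega) _ hX,
        ih1 (by omega) _ (by omega), ih0 (by omega) _ hr, coeff_X_mul,
        coeff_eq_zero_of_natDegree_lt (show r.natDegree < k + 1 by omega), orthoOff]
      field_simp
      ring
    have hprev : moment w μ (orthoPoly w μ (k + 2) * orthoPoly w μ (k + 1)) = 0 := by
      have e : orthoPoly w μ (k + 2) * orthoPoly w μ (k + 1) =
          X * orthoPoly w μ (k + 1) * orthoPoly w μ (k + 1) -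
          C (orthoDiag w μ (k + 1)) * (orthoPoly w μ (k + 1) * orthoPoly w μ (k + 1)) -
          C (orthoOff w μ k) * (orthoPoly w μ (k + 1) * orthoPoly w μ k) := by
        rw [orthoPoly_add_two]; ring
      rw [e, moment_sub, moment_sub, moment_C_mul, moment_C_mul,
        ih1 (by omega) (orthoPoly w μ k) (by simp [natDegree_orthoPoly]),
        coeff_eq_zero_of_natDegree_lt (p := orthoPoly w μ k) (n := k + 1)
          (by simp [natDegree_orthoPoly]), orthoDiag]
      change _ - _ / _ * orthoNorm w μ (k + 1) - _ = 0
      field_simp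
      ring
    set q₁ := q - C (q.coeff (k + 2)) * orthoPoly w μ (k + 2) with hq₁
    set q₂ := q₁ - C (q₁.coeff (k + 1)) * orthoPoly w μ (k + 1) with hq₂
    have hlead : ∀ (p : ℝ[X]) (j : ℕ), p.natDegree ≤ j + 1 →
        (p - C (p.coeff (j + 1)) * orthoPoly w μ (j + 1)).natDegree ≤ j := by
      intro p j hp
      rw [natDegree_le_iff_coeff_eq_zero]
      intro i hi
      rw [coeff_sub, coeff_C_mul]
      rcases (show i = j + 1 ∨ j + 1 < i by omega) with rfl | hi
      · rw [coeff_orthoPoly, mul_one, sub_self]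
      · rw [coeff_eq_zero_of_natDegree_lt (by omega),
          coeff_eq_zero_of_natDegree_lt (p := orthoPoly w μ (j + 1))
            (by rw [natDegree_orthoPoly]; omega), mul_zero, sub_zero]
    have hd₁ : q₁.natDegree ≤ k + 1 := hlead q (k + 1) hq
    have hd₂ : q₂.natDegree ≤ k := hlead q₁ k hd₁
    have e : q = C (q.coeff (k + 2)) * orthoPoly w μ (k + 2) +
        (C (q₁.coeff (k + 1)) * orthoPoly w μ (k + 1) + q₂) := by
      rw [hq₂, hq₁]; ring
    conv_lhs => rw [e, mul_add, mul_add, moment_add, moment_add, mul_left_comm, moment_C_mul,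
      mul_left_comm, moment_C_mul, hprev, hlow q₂ hd₂]
    rw [orthoNorm]; ring

theorem eval_orthoPoly_self (hw : ∀ i, 0 < w i) (hμ : Function.Injective μ)
    (i : Fin m) : (orthoPoly w μ m).eval (μ i) = 0 := by
  have hd : (Lagrange.nodal (Finset.univ.erase i) μ).natDegree = m - 1 := by
    simp [Lagrange.natDegree_nodal, Finset.card_erase_of_mem]
  have h := moment_orthoPoly_mul hw hμ m le_rfl (Lagrange.nodal (Finset.univ.erase i) μ)
    (by omega)
  rw [moment_mul_nodal_erase, coeff_eq_zero_of_natDegree_lt (by have := i.2; omega),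
    mul_zero] at h
  have hne : ∏ j ∈ Finset.univ.erase i, (μ i - μ j) ≠ 0 :=
    Finset.prod_ne_zero_iff.2 fun j hj =>
      sub_ne_zero.2 fun e => (Finset.mem_erase.1 hj).1 (hμ e).symm
  exact (mul_eq_zero.1 ((mul_eq_zero.1 h).resolve_left (hw i).ne')).resolve_right hne

theorem eval_orthoPoly_pred (hw : ∀ i, 0 < w i) (hμ : Function.Injective μ)
    (i : Fin m) :
    w i * ((orthoPoly w μ (m - 1)).eval (μ i) * ∏ j ∈ Finset.univ.erase i, (μ i - μ j)) =
      orthoNorm w μ (m - 1) := by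
  have hd : (Lagrange.nodal (Finset.univ.erase i) μ).natDegree = m - 1 := by
    simp [Lagrange.natDegree_nodal, Finset.card_erase_of_mem]
  rw [← moment_mul_nodal_erase,
    moment_orthoPoly_mul hw hμ (m - 1) (Nat.sub_le _ _) _ hd.le]
  have := (Lagrange.nodal_monic (s := Finset.univ.erase i) (v := μ)).coeff_natDegree
  rw [hd] at this
  rw [this, mul_one]

end Positive

end Ortho

/-! ### Uniqueness of the recurrence coefficients -/

theorem jacobiPoly_coeff_unique {β γ β' γ' : ℕ → ℝ} (hγ : ∀ k, 0 < γ k) (k : ℕ)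
    (h1 : jacobiPoly β γ (k + 1) = jacobiPoly β' γ' (k + 1))
    (h0 : jacobiPoly β γ k = jacobiPoly β' γ' k) :
    (∀ j < k + 1, β j = β' j) ∧ ∀ j < k, γ j = γ' j := by
  induction k with
  | zero =>
    have h : β 0 = β' 0 := by simpa [jacobiPoly] using h1
    refine ⟨fun j hj => ?_, fun j hj => absurd hj (by omega)⟩
    obtain rfl : j = 0 := by omega
    exact h
  | succ k ih =>
    have key : C (β' (k + 1) - β (k + 1)) * jacobiPoly β γ (k + 1) =
        C (γ k) * jacobiPoly β γ k - C (γ' k) * jacobiPoly β' γ' k := by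
      rw [jacobiPoly_add_two, jacobiPoly_add_two, ← h0] at h1
      rw [C_sub]
      linear_combination h1
    have hm : ∀ β γ j, (jacobiPoly β γ j).coeff j = 1 := fun β γ j => by
      have := (monic_jacobiPoly (β := β) (γ := γ) j).coeff_natDegree
      rwa [natDegree_jacobiPoly] at this
    have hz : ∀ β γ j, (jacobiPoly β γ j).coeff (j + 1) = 0 := fun β γ j =>
      coeff_eq_zero_of_natDegree_lt (by rw [natDegree_jacobiPoly]; omega)
    have hβ : β (k + 1) = β' (k + 1) := by
      have := congrArg (fun p => coeff p (k + 1)) key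
      simp only [coeff_C_mul, coeff_sub, hm, hz] at this
      linarith
    rw [hβ, sub_self, C_0, zero_mul] at key
    have hγ' : γ k = γ' k := by
      have := congrArg (fun p => coeff p k) key
      simp only [coeff_C_mul, coeff_sub, hm, coeff_zero] at this
      linarith
    rw [← hγ', ← mul_sub, eq_comm, mul_eq_zero, C_eq_zero] at key
    obtain ⟨ihβ, ihγ⟩ := ih h0 (sub_eq_zero.1 (key.resolve_left (hγ k).ne'))
    refine ⟨fun j hj => ?_, fun j hj => ?_⟩
    · rcases (show j < k + 1 ∨ j = k + 1 by omega) with h | rfl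
      exacts [ihβ j h, hβ]
    · rcases (show j < k ∨ j = k by omega) with h | rfl
      exacts [ihγ j h, hγ']

/-! ### The inverse spectral map -/

@[to_additive]
theorem prod_zmod_eq_prod_range {M : Type*} [CommMonoid M] (n : ℕ) [NeZero n] (g : ZMod n → M) :
    ∏ i, g i = ∏ j ∈ Finset.range n, g ((j + 1 : ℕ) : ZMod n) := by
  rw [← Equiv.prod_comp (Equiv.addRight (1 : ZMod n)) g]
  symm
  refine Finset.prod_bij (fun j _ => (j : ZMod n)) (fun _ _ => Finset.mem_univ _) ?_ ?_ ?_
  · intro i hi j hj h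
    rw [Finset.mem_range] at hi hj
    have := congrArg ZMod.val h
    rwa [ZMod.val_cast_of_lt hi, ZMod.val_cast_of_lt hj] at this
  · intro b _
    exact ⟨b.val, Finset.mem_range.2 (ZMod.val_lt b), ZMod.natCast_zmod_val b⟩
  · intro j _
    simp

section Inverse

variable {n : ℕ} [NeZero n] {α : ℝ} {x : Flaschka n}

theorem prodA_eq_pow (hx : x ∈ phaseSpace n α) : prodA x n = α ^ n := by
  rw [prodA, ← prod_zmod_eq_prod_range n x.2, hx.2.2]

theorem prodA_eq_mul (x : Flaschka n) : prodA x n = prodA x (n - 1) * x.2 0 := by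
  obtain ⟨m, hm⟩ : ∃ m, n = m + 1 := ⟨n - 1, by have := NeZero.one_le (n := n); omega⟩
  have : prodA x (m + 1) = prodA x m * x.2 ((m + 1 : ℕ) : ZMod n) := Finset.prod_range_succ _ _
  rw [← hm, ZMod.natCast_self] at this
  rw [this, show n - 1 = m by omega]

theorem eval_charPoly_pred_ne_zero (hx : x ∈ positiveRegion n) {k : ℕ} (hk : n - 1 = k + 1)
    (i : Fin (n - 1)) : (charPoly x k).eval (dirichlet x i) ≠ 0 := by
  have h := eval_charPoly_dirichlet hx i
  rw [hk] at h
  exact right_ne_zero_of_mul (jacobiPoly_derivative_mul_pos (offDiagSq_pos hx) k h).ne'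

theorem floquetMap_fst (hx : x ∈ positiveRegion n) {k : ℕ} (hk : n - 1 = k + 1)
    (i : Fin (n - 1)) : (floquetMap x).1 i = -(Real.log (x.2 0 / prodA x (n - 1)) +
      Real.log |(charPoly x k).eval (dirichlet x i)|) := by
  have h := eval_y₁_mul_y₂ hx i
  have hpos : 0 < x.2 0 / prodA x (n - 1) := div_pos (hx 0) (prodA_pos hx _)
  have e : (y₁ x n).eval (dirichlet x i) =
      -(x.2 0 / prodA x (n - 1)) * (charPoly x k).eval (dirichlet x i) := by
    have : y₁ x n = y₁ x (k + 2) := congrArg (y₁ x) (by omega)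
    rw [this, y₁_eq hx, hk, eval_mul, eval_C]
  have h2 : |(y₂ x (n + 1)).eval (dirichlet x i)| = |(y₁ x n).eval (dirichlet x i)|⁻¹ := by
    rw [← abs_inv, eq_inv_of_mul_eq_one_right h]
  change Real.log |(y₂ x (n + 1)).eval (dirichlet x i)| = _
  rw [h2, Real.log_inv, e, abs_mul, abs_neg, abs_of_pos hpos, Real.log_mul hpos.ne'
    (abs_ne_zero.2 (eval_charPoly_pred_ne_zero hx hk i))]

theorem phaseSpace_ext {x x' : Flaschka n} (hx : x ∈ phaseSpace n α) (hx' : x' ∈ phaseSpace n α)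
    (hb : ∀ k < n - 1, x.1 ((k + 2 : ℕ) : ZMod n) = x'.1 ((k + 2 : ℕ) : ZMod n))
    (ha : ∀ k < n - 1, x.2 ((k + 2 : ℕ) : ZMod n) = x'.2 ((k + 2 : ℕ) : ZMod n)) : x = x' := by
  obtain ⟨m, hm⟩ : ∃ m, n = m + 1 := ⟨n - 1, by have := NeZero.one_le (n := n); omega⟩
  have hm' : n - 1 = m := by omega
  rw [hm'] at hb ha
  have hs := hx.2.1.trans hx'.2.1.symm
  have hp := hx.2.2.trans hx'.2.2.symm
  rw [sum_zmod_eq_sum_range, sum_zmod_eq_sum_range] at hs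
  rw [prod_zmod_eq_prod_range, prod_zmod_eq_prod_range] at hp
  have hr : Finset.range n = Finset.range (m + 1) := by rw [hm]
  rw [hr, Finset.sum_range_succ', Finset.sum_range_succ',
    Finset.sum_congr rfl fun k hk => hb k (Finset.mem_range.1 hk), add_right_inj] at hs
  rw [hr, Finset.prod_range_succ', Finset.prod_range_succ',
    Finset.prod_congr rfl fun k hk => ha k (Finset.mem_range.1 hk)] at hp
  have hp1 := mul_left_cancel₀ (Finset.prod_pos fun k _ => hx'.1 ((k + 2 : ℕ) : ZMod n)).ne' hp
  have hrep : ∀ i : ZMod n, i = ((0 + 1 : ℕ) : ZMod n) ∨ ∃ k < m, i = ((k + 2 : ℕ) : ZMod n) := by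
    intro i
    have hv : (i - 1).val < m + 1 := by rw [← hm]; exact ZMod.val_lt _
    have hi : i = (((i - 1).val + 1 : ℕ) : ZMod n) := by
      rw [Nat.cast_add, ZMod.natCast_zmod_val, Nat.cast_one, sub_add_cancel]
    rcases h : (i - 1).val with _ | k
    · left; rwa [h] at hi
    · right; rw [h] at hi hv; exact ⟨k, by omega, hi⟩
  refine Prod.ext (funext fun i => ?_) (funext fun i => ?_) <;>
    rcases hrep i with rfl | ⟨k, hk, rfl⟩
  exacts [hs, hb k hk, hp1, ha k hk]

theorem floquetMap_injOn : Set.InjOn floquetMap (phaseSpace n α) := by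
  intro x hx x' hx' h
  have hp := phaseSpace_subset n α hx
  have hp' := phaseSpace_subset n α hx'
  have hμ : dirichlet x = dirichlet x' := congrArg Prod.snd h
  rcases hk : n - 1 with _ | k
  · exact phaseSpace_ext hx hx' (fun k h => by omega) (fun k h => by omega)
  have hP : charPoly x (k + 1) = charPoly x' (k + 1) := by
    rw [← hk, charPoly_eq_prod hp, charPoly_eq_prod hp', hμ]
  set c := x.2 0 / prodA x (n - 1) with hc
  set c' := x'.2 0 / prodA x' (n - 1) with hc'
  have hcpos : 0 < c := div_pos (hp 0) (prodA_pos hp _)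
  have hcpos' : 0 < c' := div_pos (hp' 0) (prodA_pos hp' _)
  have hval : ∀ i, c * (charPoly x k).eval (dirichlet x i) =
      c' * (charPoly x' k).eval (dirichlet x i) := by
    intro i
    have hf : (floquetMap x).1 i = (floquetMap x').1 i := by rw [h]
    have hne := eval_charPoly_pred_ne_zero hp hk i
    have hne' := eval_charPoly_pred_ne_zero hp' hk i
    rw [floquetMap_fst hp hk, floquetMap_fst hp' hk, neg_inj, ← hc, ← hc',
      ← Real.log_mul hcpos.ne' (abs_ne_zero.2 hne), ← Real.log_mul hcpos'.ne' (abs_ne_zero.2 hne')]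
      at hf
    have habs := Real.log_injOn_pos (mul_pos hcpos (abs_pos.2 hne))
      (mul_pos hcpos' (abs_pos.2 hne')) hf
    rw [← hμ] at habs
    have h0 := eval_charPoly_dirichlet hp i
    have h0' := h0
    rw [hk] at h0 h0'
    rw [hP] at h0'
    have s1 := jacobiPoly_derivative_mul_pos (offDiagSq_pos hp) k h0
    have s2 := jacobiPoly_derivative_mul_pos (offDiagSq_pos hp') k h0'
    rw [← charPoly, ← charPoly] at s1 s2
    rw [hP] at s1
    rcases pos_and_pos_or_neg_and_neg_of_mul_pos s1 with ⟨d, q⟩ | ⟨d, q⟩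
    · have q' := (pos_iff_pos_of_mul_pos s2).1 d
      rwa [abs_of_pos q, abs_of_pos q'] at habs
    · have q' := (neg_iff_neg_of_mul_pos s2).1 d
      rw [abs_of_neg q, abs_of_neg q'] at habs
      linarith
  have hpoly : C c * charPoly x k - C c' * charPoly x' k = 0 := by
    refine eq_zero_of_natDegree_lt_card_of_eval_eq_zero _ (dirichlet_strictMono hp).injective
      (fun i => ?_) ?_
    · rw [eval_sub, eval_mul, eval_mul, eval_C, eval_C, hval, sub_self]
    · rw [Fintype.card_fin, hk]
      refine Nat.lt_succ_of_le ((natDegree_sub_le _ _).trans (max_le ?_ ?_)) <;>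
      exact (natDegree_C_mul_le _ _).trans (natDegree_jacobiPoly k).le
  have hcc : c = c' := by
    have hm : ∀ y : Flaschka n, (charPoly y k).coeff k = 1 := fun y => by
      have := (monic_jacobiPoly (β := diag y) (γ := offDiagSq y) k).coeff_natDegree
      rwa [natDegree_jacobiPoly] at this
    have := congrArg (fun p => coeff p k) hpoly
    simp only [coeff_C_mul, coeff_sub, hm, coeff_zero] at this
    linarith
  have hQ : charPoly x k = charPoly x' k := by
    rw [← hcc, ← mul_sub, mul_eq_zero, C_eq_zero] at hpoly
    exact sub_eq_zero.1 (hpoly.resolve_left hcpos.ne')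
  obtain ⟨hb, ha⟩ := jacobiPoly_coeff_unique (offDiagSq_pos hp) k hP hQ
  have hlast : ∀ {y : Flaschka n}, y ∈ phaseSpace n α →
      y.2 0 ^ 2 = y.2 0 / prodA y (n - 1) * α ^ n := by
    intro y hy
    have hpy := phaseSpace_subset n α hy
    rw [← prodA_eq_pow hy, prodA_eq_mul]
    have := (prodA_pos hpy (n - 1)).ne'
    field_simp
  have ha0 : x.2 0 = x'.2 0 := by
    have := (hlast hx).trans ((congrArg (· * α ^ n) hcc).trans (hlast hx').symm)
    exact (pow_left_inj₀ (hp 0).le (hp' 0).le two_ne_zero).1 this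
  refine phaseSpace_ext hx hx' (fun j hj => hb j (by omega)) fun j hj => ?_
  rcases (show j < k ∨ j = k by omega) with h | rfl
  · exact (pow_left_inj₀ (hp _).le (hp' _).le two_ne_zero).1 (ha j h)
  · rwa [show j + 2 = n by omega, ZMod.natCast_self]

end Inverse

section InverseMap

theorem jacobiPoly_congr {β γ β' γ' : ℕ → ℝ} {m : ℕ} (hβ : ∀ k < m, β k = β' k)
    (hγ : ∀ k, k + 1 < m → γ k = γ' k) (k : ℕ) (hk : k ≤ m) :
    jacobiPoly β γ k = jacobiPoly β' γ' k := by
  induction k using Nat.twoStepInduction with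
  | zero => rfl
  | one => rw [jacobiPoly, jacobiPoly, hβ 0 (by omega)]
  | more k h0 h1 =>
    rw [jacobiPoly_add_two, jacobiPoly_add_two, h0 (by omega), h1 (by omega), hβ _ (by omega),
      hγ _ (by omega)]

variable {n : ℕ}

/-- The weights of the spectral measure attached to `(f, μ)`. -/
noncomputable def spectralWeight (z : Target n) (i : Fin (n - 1)) : ℝ :=
  Real.exp (z.1 i) / |∏ j ∈ Finset.univ.erase i, (z.2 i - z.2 j)|

/-- The entries `a_2, …, a_n` recovered from `(f, μ)`. -/
noncomputable def inverseOffDiag (n : ℕ) (α : ℝ) (z : Target n) (k : ℕ) : ℝ :=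
  if k + 1 = n - 1 then √(α ^ n / orthoNorm (spectralWeight z) z.2 k)
  else √(orthoOff (spectralWeight z) z.2 k)

/-- The entries `b_1, …, b_n` recovered from `(f, μ)`. -/
noncomputable def inverseB (z : Target n) : ℕ → ℝ
  | 0 => -∑ k ∈ Finset.range (n - 1), orthoDiag (spectralWeight z) z.2 k
  | k + 1 => orthoDiag (spectralWeight z) z.2 k

/-- The entries `a_1, …, a_n` recovered from `(f, μ)`. -/
noncomputable def inverseA (α : ℝ) (z : Target n) : ℕ → ℝ
  | 0 => α ^ n / ∏ k ∈ Finset.range (n - 1), inverseOffDiag n α z k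
  | k + 1 => inverseOffDiag n α z k

/-- The inverse of `floquetMap`, by reconstructing a Jacobi matrix from its spectral measure. -/
noncomputable def inverseMap (n : ℕ) (α : ℝ) (z : Target n) : Flaschka n :=
  (fun i => inverseB z (i - 1).val, fun i => inverseA α z (i - 1).val)

theorem prod_sub_ne_zero {z : Target n} (hz : Function.Injective z.2) (i : Fin (n - 1)) :
    ∏ j ∈ Finset.univ.erase i, (z.2 i - z.2 j) ≠ 0 :=
  Finset.prod_ne_zero_iff.2 fun _ hj =>
    sub_ne_zero.2 fun e => (Finset.mem_erase.1 hj).1 (hz e).symm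

theorem spectralWeight_pos {z : Target n} (hz : Function.Injective z.2) (i : Fin (n - 1)) :
    0 < spectralWeight z i :=
  div_pos (Real.exp_pos _) (abs_pos.2 (prod_sub_ne_zero hz i))

variable {α : ℝ} {z : Target n}

theorem inverseOffDiag_pos (hα : 0 < α) (hz : Function.Injective z.2) {k : ℕ} (hk : k < n - 1) :
    0 < inverseOffDiag n α z k := by
  rw [inverseOffDiag]
  split_ifs with h
  · exact Real.sqrt_pos.2 (div_pos (pow_pos hα n)
      (orthoNorm_pos (spectralWeight_pos hz) hz hk))
  · exact Real.sqrt_pos.2 (orthoOff_pos (spectralWeight_pos hz) hz (by omega))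

theorem prod_inverseOffDiag_pos (hα : 0 < α) (hz : Function.Injective z.2) :
    0 < ∏ k ∈ Finset.range (n - 1), inverseOffDiag n α z k :=
  Finset.prod_pos fun _ hk => inverseOffDiag_pos hα hz (Finset.mem_range.1 hk)

theorem inverseA_pos (hα : 0 < α) (hz : Function.Injective z.2) {k : ℕ} (hk : k < n) :
    0 < inverseA α z k := by
  rcases k with _ | k
  · exact div_pos (pow_pos hα n) (prod_inverseOffDiag_pos hα hz)
  · exact inverseOffDiag_pos hα hz (by omega)

theorem val_natCast_succ_sub_one {j : ℕ} (hj : j < n) :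
    (((j + 1 : ℕ) : ZMod n) - 1).val = j := by
  rw [Nat.cast_add, Nat.cast_one, add_sub_cancel_right, ZMod.val_cast_of_lt hj]

theorem inverseMap_fst {j : ℕ} (hj : j < n) :
    (inverseMap n α z).1 ((j + 1 : ℕ) : ZMod n) = inverseB z j := by
  simp only [inverseMap, val_natCast_succ_sub_one hj]

theorem inverseMap_snd {j : ℕ} (hj : j < n) :
    (inverseMap n α z).2 ((j + 1 : ℕ) : ZMod n) = inverseA α z j := by
  simp only [inverseMap, val_natCast_succ_sub_one hj]

theorem charPoly_inverseMap (hz : Function.Injective z.2) {k : ℕ} (hk : k ≤ n - 1) :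
    charPoly (inverseMap n α z) k = orthoPoly (spectralWeight z) z.2 k := by
  rw [orthoPoly_eq_jacobiPoly, charPoly]
  refine jacobiPoly_congr (m := n - 1) (fun j hj => ?_) (fun j hj => ?_) k hk
  · exact inverseMap_fst (j := j + 1) (by omega)
  · rw [offDiagSq, inverseMap_snd (j := j + 1) (by omega), inverseA, inverseOffDiag,
      if_neg (by omega),
      Real.sq_sqrt (orthoOff_pos (spectralWeight_pos hz) hz (by omega)).le]

variable [NeZero n]

theorem inverseMap_mem (hα : 0 < α) (hz : Function.Injective z.2) :
    inverseMap n α z ∈ phaseSpace n α := by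
  have hr : Finset.range n = Finset.range (n - 1 + 1) := by
    have := NeZero.one_le (n := n)
    rw [Nat.sub_add_cancel this]
  refine ⟨fun i => inverseA_pos hα hz (ZMod.val_lt _), ?_, ?_⟩
  · rw [sum_zmod_eq_sum_range, Finset.sum_congr rfl fun j hj =>
      inverseMap_fst (Finset.mem_range.1 hj), hr, Finset.sum_range_succ']
    simp [inverseB]
  · rw [prod_zmod_eq_prod_range, Finset.prod_congr rfl fun j hj =>
      inverseMap_snd (Finset.mem_range.1 hj), hr, Finset.prod_range_succ']
    exact mul_div_cancel₀ _ (prod_inverseOffDiag_pos hα hz).ne'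

theorem floquetMap_inverseMap (hα : 0 < α) (hz : StrictMono z.2) :
    floquetMap (inverseMap n α z) = z := by
  have hmem := inverseMap_mem (n := n) hα hz.injective
  have hp := phaseSpace_subset n α hmem
  have hμ : dirichlet (inverseMap n α z) = z.2 := by
    refine dirichlet_eq_of_eval_eq_zero hp hz fun i => ?_
    rw [charPoly_inverseMap hz.injective le_rfl]
    exact eval_orthoPoly_self (spectralWeight_pos hz.injective) hz.injective i
  refine Prod.ext (funext fun i => ?_) hμ
  obtain ⟨k, hk⟩ : ∃ k, n - 1 = k + 1 := ⟨n - 1 - 1, by have := i.2; omega⟩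
  have hw := spectralWeight_pos hz.injective
  have hnorm := orthoNorm_pos hw hz.injective (k := k) (by omega)
  have hpred := eval_orthoPoly_pred hw hz.injective i
  have h0 : (inverseMap n α z).2 0 ^ 2 = α ^ n / orthoNorm (spectralWeight z) z.2 k := by
    have := inverseMap_snd (n := n) (α := α) (z := z) (j := k + 1) (by omega)
    rw [show k + 1 + 1 = n by omega, ZMod.natCast_self] at this
    rw [this, inverseA, inverseOffDiag, if_pos hk.symm,
      Real.sq_sqrt (div_pos (pow_pos hα n) hnorm).le]
  have hc : (inverseMap n α z).2 0 / prodA (inverseMap n α z) (n - 1) =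
      (orthoNorm (spectralWeight z) z.2 k)⁻¹ := by
    have h1 := prodA_eq_mul (inverseMap n α z)
    rw [prodA_eq_pow hmem] at h1
    have h2 := (prodA_pos hp (n - 1)).ne'
    have h3 := (hp 0).ne'
    have h4 := (pow_pos hα n).ne'
    rw [h1] at h0
    field_simp at h0 ⊢
    linarith
  rw [floquetMap_fst hp hk, hc, hμ, charPoly_inverseMap hz.injective (by omega)]
  rw [show n - 1 - 1 = k by omega] at hpred
  have habs := congrArg abs hpred
  rw [abs_mul, abs_mul, abs_of_pos (hw i), abs_of_pos hnorm, spectralWeight] at habs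
  have hprod := abs_ne_zero.2 (prod_sub_ne_zero hz.injective i)
  have hQ : |(orthoPoly (spectralWeight z) z.2 k).eval (z.2 i)| =
      orthoNorm (spectralWeight z) z.2 k * Real.exp (-z.1 i) := by
    rw [← habs, Real.exp_neg]
    have := (Real.exp_pos (z.1 i)).ne'
    field_simp
  rw [hQ, Real.log_mul hnorm.ne' (Real.exp_pos _).ne', Real.log_exp, Real.log_inv]
  ring

theorem floquetMap_image (hα : 0 < α) :
    floquetMap '' phaseSpace n α = {z : Target n | StrictMono z.2} := by
  ext z
  constructor
  · rintro ⟨x, hx, rfl⟩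
    exact dirichlet_strictMono (phaseSpace_subset n α hx)
  · intro hz
    exact ⟨inverseMap n α z, inverseMap_mem hα (StrictMono.injective hz), floquetMap_inverseMap hα hz⟩

theorem inverseMap_invOn (hα : 0 < α) :
    Set.InvOn (inverseMap n α) floquetMap (phaseSpace n α) (floquetMap '' phaseSpace n α) := by
  constructor
  · intro x hx
    have hs := dirichlet_strictMono (phaseSpace_subset n α hx)
    exact floquetMap_injOn (inverseMap_mem hα hs.injective) hx (floquetMap_inverseMap hα hs)
  · rw [floquetMap_image hα]
    intro z hz
    exact floquetMap_inverseMap hα hz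

end InverseMap

/-! ### Smoothness of the inverse -/

theorem isOpen_setOf_strictMono (k : ℕ) : IsOpen {μ : Fin k → ℝ | StrictMono μ} := by
  have : {μ : Fin k → ℝ | StrictMono μ} =
      ⋂ i : Fin k, ⋂ j : Fin k, ⋂ _ : i < j, {μ : Fin k → ℝ | μ i < μ j} := by
    ext μ
    simp only [Set.mem_ofPred_eq, Set.mem_iInter]
    rfl
  rw [this]
  exact isOpen_iInter_of_finite fun i => isOpen_iInter_of_finite fun j =>
    isOpen_iInter_of_finite fun _ => isOpen_lt (continuous_apply i) (continuous_apply j)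

section SmoothInverse

variable {n : ℕ}

/-- The pairs `(f, μ)` with `μ_1 < ⋯ < μ_{n-1}`. -/
def orderedRegion (n : ℕ) : Set (Target n) := {z | StrictMono z.2}

theorem isOpen_orderedRegion (n : ℕ) : IsOpen (orderedRegion n) :=
  (isOpen_setOf_strictMono (n - 1)).preimage continuous_snd

theorem contDiffOn_target_fst (i : Fin (n - 1)) (s : Set (Target n)) :
    ContDiffOn ℝ ∞ (fun z : Target n => z.1 i) s :=
  ((contDiff_apply ℝ ℝ i).comp contDiff_fst).contDiffOn

theorem contDiffOn_target_snd (i : Fin (n - 1)) (s : Set (Target n)) :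
    ContDiffOn ℝ ∞ (fun z : Target n => z.2 i) s :=
  ((contDiff_apply ℝ ℝ i).comp contDiff_snd).contDiffOn

theorem contDiffOn_spectralWeight (i : Fin (n - 1)) :
    ContDiffOn ℝ ∞ (fun z : Target n => spectralWeight z i) (orderedRegion n) := by
  have hp : ∀ z ∈ orderedRegion n, ∏ j ∈ Finset.univ.erase i, (z.2 i - z.2 j) ≠ 0 :=
    fun z hz => prod_sub_ne_zero (StrictMono.injective hz) i
  exact (contDiffOn_target_fst i _).exp.div
    ((contDiffOn_prod fun j _ => (contDiffOn_target_snd i _).sub (contDiffOn_target_snd j _)).abs hp)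
    fun z hz => abs_ne_zero.2 (hp z hz)

theorem contDiffOn_moment {q : Target n → ℝ[X]}
    (hq : ∀ i, ContDiffOn ℝ ∞ (fun z => (q z).eval (z.2 i)) (orderedRegion n)) :
    ContDiffOn ℝ ∞ (fun z => moment (spectralWeight z) z.2 (q z)) (orderedRegion n) :=
  ContDiffOn.sum fun i _ => (contDiffOn_spectralWeight i).mul (hq i)

theorem orthoNorm_ne_zero {z : Target n} (hz : z ∈ orderedRegion n) {k : ℕ} (hk : k < n - 1) :
    orthoNorm (spectralWeight z) z.2 k ≠ 0 :=
  (orthoNorm_pos (spectralWeight_pos (StrictMono.injective hz)) (StrictMono.injective hz) hk).ne'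

/-- The values of `p_k` on the nodes depend smoothly on the data. -/
def SmoothOrthoValues (n k : ℕ) : Prop :=
  ∀ i, ContDiffOn ℝ ∞ (fun z : Target n => (orthoPoly (spectralWeight z) z.2 k).eval (z.2 i))
    (orderedRegion n)

theorem SmoothOrthoValues.orthoNorm {k : ℕ} (h : SmoothOrthoValues n k) :
    ContDiffOn ℝ ∞ (fun z : Target n => orthoNorm (spectralWeight z) z.2 k) (orderedRegion n) :=
  contDiffOn_moment fun i => by simpa only [eval_mul] using (h i).mul (h i)

theorem SmoothOrthoValues.orthoDiag {k : ℕ} (h : SmoothOrthoValues n k) (hk : k < n - 1) :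
    ContDiffOn ℝ ∞ (fun z : Target n => orthoDiag (spectralWeight z) z.2 k) (orderedRegion n) :=
  (contDiffOn_moment fun i => by
    simpa only [eval_mul, eval_X] using ((contDiffOn_target_snd i _).mul (h i)).mul (h i)).div
      h.orthoNorm fun _ hz => orthoNorm_ne_zero hz hk

theorem SmoothOrthoValues.orthoOff {k : ℕ} (h : SmoothOrthoValues n k)
    (h' : SmoothOrthoValues n (k + 1)) (hk : k < n - 1) :
    ContDiffOn ℝ ∞ (fun z : Target n => orthoOff (spectralWeight z) z.2 k) (orderedRegion n) :=
  h'.orthoNorm.div h.orthoNorm fun _ hz => orthoNorm_ne_zero hz hk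

theorem smoothOrthoValues (k : ℕ) (hk : k ≤ n - 1) : SmoothOrthoValues n k := by
  induction k using Nat.twoStepInduction with
  | zero =>
    intro i
    simpa only [orthoPoly, orthoPair, eval_one] using contDiffOn_const
  | one =>
    have h0 : SmoothOrthoValues n 0 := fun i => by
      simpa only [orthoPoly, orthoPair, eval_one] using contDiffOn_const
    intro i
    simpa only [orthoPoly_one, eval_sub, eval_X, eval_C] using
      (contDiffOn_target_snd i _).sub (h0.orthoDiag (by omega))
  | more k ih0 ih1 =>
    have h0 := ih0 (by omega)
    have h1 := ih1 (by omega)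
    intro i
    simpa only [orthoPoly_add_two, eval_sub, eval_mul, eval_X, eval_C] using
      (((contDiffOn_target_snd i _).sub (h1.orthoDiag (by omega))).mul (h1 i)).sub
        ((h0.orthoOff h1 (by omega)).mul (h0 i))

theorem contDiffOn_inverseOffDiag {α : ℝ} (hα : 0 < α) {k : ℕ} (hk : k < n - 1) :
    ContDiffOn ℝ ∞ (fun z : Target n => inverseOffDiag n α z k) (orderedRegion n) := by
  have hs := smoothOrthoValues (n := n) k hk.le
  unfold inverseOffDiag
  split_ifs with h
  · exact (contDiffOn_const.div hs.orthoNorm fun z hz => orthoNorm_ne_zero hz hk).sqrt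
      fun z hz => div_ne_zero (pow_pos hα n).ne' (orthoNorm_ne_zero hz hk)
  · exact (hs.orthoOff (smoothOrthoValues (k + 1) hk) hk).sqrt fun z hz =>
      div_ne_zero (orthoNorm_ne_zero hz (by omega)) (orthoNorm_ne_zero hz hk)

theorem contDiffOn_inverseMap [NeZero n] {α : ℝ} (hα : 0 < α) :
    ContDiffOn ℝ ∞ (inverseMap n α) (orderedRegion n) := by
  refine ContDiffOn.prodMk (contDiffOn_pi.2 fun i => ?_) (contDiffOn_pi.2 fun i => ?_) <;>
    have hi : (i - 1).val < n := ZMod.val_lt _ <;> rcases hv : (i - 1).val with _ | k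
  · exact (ContDiffOn.sum fun k hk => (smoothOrthoValues k (Finset.mem_range.1 hk).le).orthoDiag
      (Finset.mem_range.1 hk)).neg
  · exact (smoothOrthoValues k (by omega)).orthoDiag (by omega)
  · exact contDiffOn_const.div (contDiffOn_prod fun k hk =>
      contDiffOn_inverseOffDiag hα (Finset.mem_range.1 hk))
      fun z hz => (prod_inverseOffDiag_pos hα (StrictMono.injective hz)).ne'
  · exact contDiffOn_inverseOffDiag hα (by omega)

end SmoothInverse

/-! ### Smoothness of the map -/

/-- The implicit function theorem for a real unknown. -/
theorem exists_contDiffAt_implicit {E : Type*} [NormedAddCommGroup E] [NormedSpace ℝ E]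
    [CompleteSpace E] {f : E × ℝ → ℝ} {x : E} {r d : ℝ} (hf : ContDiffAt ℝ ∞ f (x, r))
    (hd : HasDerivAt (fun t => f (x, t)) d r) (hd0 : d ≠ 0) (h0 : f (x, r) = 0) :
    ∃ g : E → ℝ, ContDiffAt ℝ ∞ g x ∧ g x = r ∧ ∀ᶠ y in nhds x, f (y, g y) = 0 := by
  have hn : (∞ : WithTop ℕ∞) ≠ 0 := by simp
  have hdiff := (hf.differentiableAt hn).hasFDerivAt
  have hcurve : HasDerivAt (fun t : ℝ => (x, t)) ((0 : E), (1 : ℝ)) r :=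
    (hasDerivAt_const r x).prodMk (hasDerivAt_id r)
  have hval : fderiv ℝ f (x, r) ((0 : E), (1 : ℝ)) = d :=
    (hdiff.comp_hasDerivAt r hcurve).unique hd
  have hinv : (fderiv ℝ f (x, r) ∘L .inr ℝ E ℝ).IsInvertible := by
    refine ⟨ContinuousLinearEquiv.unitsEquivAut ℝ (Units.mk0 d hd0), ?_⟩
    ext
    simp [hval]
  refine ⟨hf.implicitFunction hn hinv, hf.contDiffAt_implicitFunction hn hinv,
    hf.implicitFunction_apply_self hn hinv, ?_⟩
  filter_upwards [hf.eventually_apply_implicitFunction hn hinv] with y hy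
  rw [hy, h0]

section Smooth

variable {n : ℕ}

theorem contDiff_flaschka_fst [NeZero n] (i : ZMod n) : ContDiff ℝ ∞ (fun x : Flaschka n => x.1 i) :=
  (contDiff_apply ℝ ℝ i).comp contDiff_fst

theorem contDiff_flaschka_snd [NeZero n] (i : ZMod n) : ContDiff ℝ ∞ (fun x : Flaschka n => x.2 i) :=
  (contDiff_apply ℝ ℝ i).comp contDiff_snd

theorem contDiff_eval_charPoly [NeZero n] (k : ℕ) :
    ContDiff ℝ ∞ (fun u : Flaschka n × ℝ => (charPoly u.1 k).eval u.2) := by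
  induction k using Nat.twoStepInduction with
  | zero => simpa only [charPoly, jacobiPoly, eval_one] using contDiff_const
  | one =>
    simp only [charPoly, jacobiPoly, eval_sub, eval_X, eval_C]
    exact contDiff_snd.sub ((contDiff_flaschka_fst _).comp contDiff_fst)
  | more k h0 h1 =>
    simp only [charPoly] at h0 h1
    simp only [charPoly, jacobiPoly_add_two, eval_sub, eval_mul, eval_X, eval_C]
    exact ((contDiff_snd.sub ((contDiff_flaschka_fst _).comp contDiff_fst)).mul h1).sub
        ((((contDiff_flaschka_snd _).comp contDiff_fst).pow 2).mul h0)

theorem contDiffAt_eval_solution [NeZero n] {x : Flaschka n} (hx : x ∈ positiveRegion n)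
    (s₀ s₁ : ℝ) {l : Flaschka n → ℝ} (hl : ContDiffAt ℝ ∞ l x) (k : ℕ) :
    ContDiffAt ℝ ∞ (fun y => (solution y s₀ s₁ k).eval (l y)) x := by
  induction k using Nat.twoStepInduction with
  | zero => simpa only [solution, eval_C] using contDiffAt_const
  | one => simpa only [solution, eval_C] using contDiffAt_const
  | more k h0 h1 =>
    simp only [solution, eval_sub, eval_mul, eval_X, eval_C]
    exact ((contDiff_flaschka_snd _).contDiffAt.inv (hx _).ne').mul
        (((hl.sub (contDiff_flaschka_fst _).contDiffAt).mul h1).sub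
          ((contDiff_flaschka_snd _).contDiffAt.mul h0))

variable [NeZero n] {x : Flaschka n}

theorem eval_derivative_charPoly_ne_zero (hx : x ∈ positiveRegion n) (i : Fin (n - 1)) :
    (derivative (charPoly x (n - 1))).eval (dirichlet x i) ≠ 0 := by
  have h := eval_charPoly_dirichlet hx i
  obtain ⟨k, hk⟩ : ∃ k, n - 1 = k + 1 := ⟨n - 1 - 1, by have := i.2; omega⟩
  rw [hk] at h ⊢
  exact left_ne_zero_of_mul (jacobiPoly_derivative_mul_pos (offDiagSq_pos hx) k h).ne'

theorem contDiffAt_dirichlet (hx : x ∈ positiveRegion n) : ContDiffAt ℝ ∞ dirichlet x := by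
  have key : ∀ i, ∃ g : Flaschka n → ℝ, ContDiffAt ℝ ∞ g x ∧ g x = dirichlet x i ∧
      ∀ᶠ y in nhds x, (charPoly y (n - 1)).eval (g y) = 0 := fun i =>
    exists_contDiffAt_implicit (f := fun u => (charPoly u.1 (n - 1)).eval u.2)
      (contDiff_eval_charPoly (n - 1)).contDiffAt ((charPoly x (n - 1)).hasDerivAt (dirichlet x i))
      (eval_derivative_charPoly_ne_zero hx i) (eval_charPoly_dirichlet hx i)
  choose g hg hgx hg0 using key
  have hgc : ContDiffAt ℝ ∞ (fun y i => g i y) x := contDiffAt_pi.2 hg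
  have hmono : ∀ᶠ y in nhds x, StrictMono fun i => g i y :=
    hgc.continuousAt.eventually ((isOpen_setOf_strictMono (n - 1)).mem_nhds (by
      have : (fun i => g i x) = dirichlet x := funext hgx
      change (fun i => g i x) ∈ _
      rw [this]
      exact dirichlet_strictMono hx))
  refine hgc.congr_of_eventuallyEq ?_
  filter_upwards [hmono, Filter.eventually_all.2 hg0,
    (isOpen_positiveRegion n).mem_nhds hx] with y h1 h2 h3
  exact dirichlet_eq_of_eval_eq_zero h3 h1 h2

theorem y₂_ne_zero (hx : x ∈ positiveRegion n) (i : Fin (n - 1)) :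
    (y₂ x (n + 1)).eval (dirichlet x i) ≠ 0 :=
  right_ne_zero_of_mul ((eval_y₁_mul_y₂ hx i).trans_ne one_ne_zero)

theorem contDiffAt_floquetMap (hx : x ∈ positiveRegion n) : ContDiffAt ℝ ∞ floquetMap x := by
  refine ContDiffAt.prodMk (contDiffAt_pi.2 fun i => ?_) (contDiffAt_dirichlet hx)
  simp only [Real.log_abs]
  exact (contDiffAt_eval_solution hx 0 1 (contDiffAt_pi.1 (contDiffAt_dirichlet hx) i)
    (n + 1)).log (y₂_ne_zero hx i)

theorem contDiffOn_floquetMap : ContDiffOn ℝ ∞ floquetMap (positiveRegion n) :=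
  fun _ hx => (contDiffAt_floquetMap hx).contDiffWithinAt

end Smooth

/-! ### The differential of the map and the symplectic form -/

/-- Summation by parts for the double sum that defines the symplectic form. -/
theorem sum_Icc_add_sum_range (A B : ℕ → ℝ) (m : ℕ) :
    (∑ i ∈ Finset.Icc 2 (m + 1), ∑ j ∈ Finset.Icc 1 (i - 1), B i * A j) +
      ∑ j ∈ Finset.range m, A (j + 2) * ∑ i ∈ Finset.range (j + 1), B (i + 2) =
    (∑ j ∈ Finset.range m, B (j + 2)) * ∑ j ∈ Finset.range (m + 1), A (j + 1) := by
  induction m with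
  | zero => simp
  | succ m ih =>
    have h1 : ∑ j ∈ Finset.Icc 1 (m + 1 + 1 - 1), B (m + 1 + 1) * A j =
        B (m + 2) * ∑ j ∈ Finset.range (m + 1), A (j + 1) := by
      rw [← Finset.mul_sum, Nat.add_sub_cancel, Finset.range_eq_Ico,
        Finset.sum_Ico_add' A 0 (m + 1) 1]
      rfl
    have h2 := Finset.sum_range_succ (fun j => B (j + 2)) m
    rw [Finset.sum_Icc_succ_top (by omega), h1, Finset.sum_range_succ _ (m + 1),
      Finset.sum_range_succ (fun j => A (j + 2) * _) m]
    linear_combination ih - (∑ j ∈ Finset.range (m + 1), A (j + 1)) * h2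

section Differential

variable {n : ℕ} {x : Flaschka n}

/-- The differential of `log a_j`. -/
noncomputable def logDerivA (x u : Flaschka n) (j : ℕ) : ℝ :=
  u.2 (j : ZMod n) / x.2 (j : ZMod n)

/-- The differential of `a_{k+2}²`. -/
noncomputable def offDiagSqVar (x u : Flaschka n) (k : ℕ) : ℝ :=
  2 * x.2 ((k + 2 : ℕ) : ZMod n) * u.2 ((k + 2 : ℕ) : ZMod n)

theorem hasDerivAt_line_fst (x u : Flaschka n) (i : ZMod n) :
    HasDerivAt (fun t : ℝ => (x + t • u).1 i) (u.1 i) 0 := by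
  simpa using ((hasDerivAt_id (0 : ℝ)).mul_const (u.1 i)).const_add (x.1 i)

theorem hasDerivAt_line_snd (x u : Flaschka n) (i : ZMod n) :
    HasDerivAt (fun t : ℝ => (x + t • u).2 i) (u.2 i) 0 := by
  simpa using ((hasDerivAt_id (0 : ℝ)).mul_const (u.2 i)).const_add (x.2 i)

theorem hasDerivAt_log_snd (hx : x ∈ positiveRegion n) (u : Flaschka n) (j : ℕ) :
    HasDerivAt (fun t : ℝ => Real.log ((x + t • u).2 (j : ZMod n))) (logDerivA x u j) 0 := by
  have := (hasDerivAt_line_snd x u (j : ZMod n)).log (by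
    rw [zero_smul, add_zero]; exact (hx _).ne')
  rwa [zero_smul, add_zero] at this

variable [NeZero n]

theorem hasDerivAt_floquetMap (hx : x ∈ positiveRegion n) (u : Flaschka n) :
    HasDerivAt (fun t : ℝ => floquetMap (x + t • u)) (fderiv ℝ floquetMap x u) 0 :=
  ((contDiffAt_floquetMap hx).differentiableAt (by simp)).hasFDerivAt.hasLineDerivAt u

theorem hasDerivAt_dirichlet (hx : x ∈ positiveRegion n) (u : Flaschka n) (i : Fin (n - 1)) :
    HasDerivAt (fun t : ℝ => dirichlet (x + t • u) i) ((fderiv ℝ floquetMap x u).2 i) 0 :=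
  hasDerivAt_pi.1 (hasDerivAt_floquetMap hx u).snd i

theorem hasDerivAt_floquetMap_fst (hx : x ∈ positiveRegion n) (u : Flaschka n) (i : Fin (n - 1)) :
    HasDerivAt (fun t : ℝ => (floquetMap (x + t • u)).1 i) ((fderiv ℝ floquetMap x u).1 i) 0 :=
  hasDerivAt_pi.1 (hasDerivAt_floquetMap hx u).fst i

theorem eventually_line_mem (hx : x ∈ positiveRegion n) (u : Flaschka n) :
    ∀ᶠ t : ℝ in nhds 0, x + t • u ∈ positiveRegion n := by
  have hc : Continuous fun t : ℝ => x + t • u := by fun_prop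
  exact hc.continuousAt.eventually ((isOpen_positiveRegion n).mem_nhds (by simpa using hx))

theorem hasDerivAt_eval_charPoly (hx : x ∈ positiveRegion n) (u : Flaschka n) (i : Fin (n - 1))
    (k : ℕ) :
    HasDerivAt (fun t : ℝ => (charPoly (x + t • u) k).eval (dirichlet (x + t • u) i))
      ((jacobiVar (diag x) (offDiagSq x) (diag u) (offDiagSqVar x u) k).eval (dirichlet x i) +
        (derivative (charPoly x k)).eval (dirichlet x i) * (fderiv ℝ floquetMap x u).2 i) 0 := by
  have h := hasDerivAt_eval_jacobiPoly (β := fun t => diag (x + t • u))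
    (γ := fun t => offDiagSq (x + t • u)) (β' := diag u) (γ' := offDiagSqVar x u)
    (t := 0) (fun k => hasDerivAt_line_fst x u _)
    (fun k => by
      refine ((hasDerivAt_line_snd x u ((k + 2 : ℕ) : ZMod n)).pow 2).congr_deriv ?_
      simp [offDiagSqVar])
    (hasDerivAt_dirichlet hx u i) k
  simpa only [zero_smul, add_zero, charPoly] using h

/-- The differential of a Dirichlet eigenvalue. -/
theorem fderiv_dirichlet (hx : x ∈ positiveRegion n) (u : Flaschka n) {k : ℕ} (hk : n - 1 = k)
    (i : Fin (n - 1)) :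
    (fderiv ℝ floquetMap x u).2 i =
      -((jacobiVar (diag x) (offDiagSq x) (diag u) (offDiagSqVar x u) k).eval
        (dirichlet x i) / (derivative (charPoly x k)).eval (dirichlet x i)) := by
  have h := hasDerivAt_eval_charPoly hx u i k
  have h0 : HasDerivAt (fun t : ℝ => (charPoly (x + t • u) k).eval (dirichlet (x + t • u) i))
      0 0 := by
    refine (hasDerivAt_const (0 : ℝ) (0 : ℝ)).congr_of_eventuallyEq ?_
    filter_upwards [eventually_line_mem hx u] with t ht
    rw [← hk]
    exact eval_charPoly_dirichlet ht i
  have hne := eval_derivative_charPoly_ne_zero hx i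
  rw [hk] at hne
  have := h.unique h0
  field_simp
  linarith

/-- The differential of `f_i`. -/
theorem fderiv_floquetMap_fst (hx : x ∈ positiveRegion n) (u : Flaschka n) {k : ℕ}
    (hk : n - 1 = k + 1) (i : Fin (n - 1)) :
    (fderiv ℝ floquetMap x u).1 i =
      -((logDerivA x u n - ∑ j ∈ Finset.range (n - 1), logDerivA x u (j + 1)) +
        ((jacobiVar (diag x) (offDiagSq x) (diag u) (offDiagSqVar x u) k).eval (dirichlet x i) +
          (derivative (charPoly x k)).eval (dirichlet x i) * (fderiv ℝ floquetMap x u).2 i) /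
        (charPoly x k).eval (dirichlet x i)) := by
  refine (hasDerivAt_floquetMap_fst hx u i).unique ?_
  have hQ := (hasDerivAt_eval_charPoly hx u i k).log (by
    rw [zero_smul, add_zero]; exact eval_charPoly_pred_ne_zero hx hk i)
  rw [zero_smul, add_zero] at hQ
  have hc := (hasDerivAt_log_snd hx u n).sub
    (HasDerivAt.fun_sum (u := Finset.range (n - 1)) fun j _ => hasDerivAt_log_snd hx u (j + 1))
  refine (hc.add hQ).neg.congr_of_eventuallyEq ?_
  filter_upwards [eventually_line_mem hx u] with t ht
  rw [floquetMap_fst ht hk, Real.log_div (ht 0).ne' (prodA_pos ht _).ne', prodA,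
    Real.log_prod fun j _ => (ht _).ne', Real.log_abs]
  simp

theorem sum_dirichlet_eq (hx : x ∈ positiveRegion n) (F : ℝ → ℝ) {k : ℕ} (hk : n - 1 = k + 1) :
    ∑ i, F (dirichlet x i) = ∑ r ∈ jacobiRoots (diag x) (offDiagSq x) (k + 1), F r := by
  classical
  have : jacobiRoots (diag x) (offDiagSq x) (k + 1) = jacobiRoots (diag x) (offDiagSq x) (n - 1) := by
    rw [hk]
  rw [this, jacobiRoots_eq_image hx,
    Finset.sum_image (dirichlet_strictMono hx).injective.injOn]

theorem sum_fderiv_wedge (hx : x ∈ positiveRegion n) {u v : Flaschka n}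
    (hu : ∑ j ∈ Finset.range n, logDerivA x u (j + 1) = 0)
    (hv : ∑ j ∈ Finset.range n, logDerivA x v (j + 1) = 0) :
    ∑ i, ((fderiv ℝ floquetMap x u).2 i * (fderiv ℝ floquetMap x v).1 i -
        (fderiv ℝ floquetMap x v).2 i * (fderiv ℝ floquetMap x u).1 i) =
      2 * ∑ i ∈ Finset.Icc 2 n, ∑ j ∈ Finset.Icc 1 (i - 1),
        (u.1 (i : ZMod n) * logDerivA x v j - v.1 (i : ZMod n) * logDerivA x u j) := by
  have hn1 := NeZero.one_le (n := n)
  obtain hk | ⟨k, hk⟩ : n - 1 = 0 ∨ ∃ k, n - 1 = k + 1 := by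
    rcases n - 1 with _ | k
    exacts [Or.inl rfl, Or.inr ⟨k, rfl⟩]
  · have : IsEmpty (Fin (n - 1)) := by rw [hk]; infer_instance
    rw [Finset.univ_eq_empty, Finset.sum_empty, Finset.Icc_eq_empty (by omega), Finset.sum_empty,
      mul_zero]
  have hγ := offDiagSq_pos hx
  have hn : n = k + 1 + 1 := by omega
  have hc : ∀ {w : Flaschka n}, ∑ j ∈ Finset.range n, logDerivA x w (j + 1) = 0 →
      logDerivA x w n - ∑ j ∈ Finset.range (n - 1), logDerivA x w (j + 1) =
        2 * logDerivA x w (k + 2) := by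
    intro w hw
    have hr : Finset.range n = Finset.range (k + 1 + 1) := by rw [hn]
    have hr' : Finset.range (n - 1) = Finset.range (k + 1) := by rw [hk]
    have he : logDerivA x w n = logDerivA x w (k + 2) := congrArg (logDerivA x w) hn
    rw [hr, Finset.sum_range_succ] at hw
    rw [hr', he]
    change _ + logDerivA x w (k + 2) = 0 at hw
    linarith
  let F : ℝ → ℝ := fun r => 2 * logDerivA x v (k + 2) *
          ((jacobiVar (diag x) (offDiagSq x) (diag u) (offDiagSqVar x u) (k + 1)).eval r /
            (derivative (jacobiPoly (diag x) (offDiagSq x) (k + 1))).eval r) -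
        2 * logDerivA x u (k + 2) *
          ((jacobiVar (diag x) (offDiagSq x) (diag v) (offDiagSqVar x v) (k + 1)).eval r /
            (derivative (jacobiPoly (diag x) (offDiagSq x) (k + 1))).eval r) +
        ((jacobiVar (diag x) (offDiagSq x) (diag u) (offDiagSqVar x u) (k + 1)).eval r *
            (jacobiVar (diag x) (offDiagSq x) (diag v) (offDiagSqVar x v) k).eval r -
          (jacobiVar (diag x) (offDiagSq x) (diag v) (offDiagSqVar x v) (k + 1)).eval r *
            (jacobiVar (diag x) (offDiagSq x) (diag u) (offDiagSqVar x u) k).eval r) /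
        ((derivative (jacobiPoly (diag x) (offDiagSq x) (k + 1))).eval r *
          (jacobiPoly (diag x) (offDiagSq x) k).eval r)
  have hterm : ∀ i, (fderiv ℝ floquetMap x u).2 i * (fderiv ℝ floquetMap x v).1 i -
        (fderiv ℝ floquetMap x v).2 i * (fderiv ℝ floquetMap x u).1 i =
      F (dirichlet x i) := by
    intro i
    have hd := eval_derivative_charPoly_ne_zero hx i
    have hq := eval_charPoly_pred_ne_zero hx hk i
    have eu := fderiv_dirichlet hx u hk i
    have ev := fderiv_dirichlet hx v hk i
    rw [hk] at hd
    rw [charPoly] at hd hq eu ev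
    rw [fderiv_floquetMap_fst hx u hk, fderiv_floquetMap_fst hx v hk, hc hu, hc hv, eu, ev, charPoly]
    simp only [F]
    field_simp
    ring
  rw [(Finset.sum_congr rfl fun i _ => hterm i).trans (sum_dirichlet_eq hx F hk)]
  simp only [F]
  rw [Finset.sum_add_distrib,
    Finset.sum_sub_distrib, ← Finset.mul_sum, ← Finset.mul_sum, sum_jacobiVar_div hγ,
    sum_jacobiVar_div hγ]
  have hres := residueSum_eq (β := diag x) (β₁ := diag u) (γ₁ := offDiagSqVar x u)
    (β₂ := diag v) (γ₂ := offDiagSqVar x v) hγ k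
  rw [residueSum] at hres
  rw [hres]
  have hg : ∀ (w : Flaschka n) (i : ℕ),
      offDiagSqVar x w i / offDiagSq x i = 2 * logDerivA x w (i + 2) := by
    intro w i
    have := (hx ((i + 2 : ℕ) : ZMod n)).ne'
    rw [offDiagSqVar, offDiagSq, logDerivA]
    field_simp
  have hparts : ∀ {w w' : Flaschka n}, ∑ j ∈ Finset.range n, logDerivA x w' (j + 1) = 0 →
      ∑ i ∈ Finset.Icc 2 n, ∑ j ∈ Finset.Icc 1 (i - 1), w.1 (i : ZMod n) * logDerivA x w' j =
        -∑ j ∈ Finset.range (k + 1),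
          logDerivA x w' (j + 2) * ∑ i ∈ Finset.range (j + 1), diag w i := by
    intro w w' hw'
    have h := sum_Icc_add_sum_range (logDerivA x w') (fun i => w.1 (i : ZMod n)) (k + 1)
    have hr : Finset.range n = Finset.range (k + 1 + 1) := by rw [hn]
    have hi : Finset.Icc 2 n = Finset.Icc 2 (k + 1 + 1) := by rw [hn]
    rw [← hr, hw', mul_zero] at h
    rw [hi]
    exact eq_neg_of_add_eq_zero_left h
  simp only [Finset.sum_sub_distrib]
  rw [hparts hu, hparts hv]
  simp only [hg, Finset.sum_range_succ _ k, mul_assoc, ← Finset.mul_sum]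
  ring

/-- The vectors tangent to the phase space preserve `∏ a_i`. -/
theorem sum_logDerivA_eq_zero {α : ℝ} (hx : x ∈ phaseSpace n α) {u : Flaschka n}
    (hu : u ∈ tangentConeAt ℝ (phaseSpace n α) x) :
    ∑ j ∈ Finset.range n, logDerivA x u (j + 1) = 0 := by
  have hp := phaseSpace_subset n α hx
  have hd : DifferentiableAt ℝ
      (fun y : Flaschka n => ∑ j ∈ Finset.range n, Real.log (y.2 ((j + 1 : ℕ) : ZMod n))) x :=
    DifferentiableAt.fun_sum fun j _ =>
      ((contDiff_flaschka_snd _).contDiffAt.differentiableAt (by simp)).log (hp _).ne'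
  have h0 : HasFDerivWithinAt
      (fun y : Flaschka n => ∑ j ∈ Finset.range n, Real.log (y.2 ((j + 1 : ℕ) : ZMod n)))
      (0 : Flaschka n →L[ℝ] ℝ) (phaseSpace n α) x := by
    have hc : ∀ y ∈ phaseSpace n α,
        ∑ j ∈ Finset.range n, Real.log (y.2 ((j + 1 : ℕ) : ZMod n)) = Real.log (α ^ n) := by
      intro y hy
      rw [← prodA_eq_pow hy, prodA, Real.log_prod fun j _ => (hy.1 _).ne']
    exact (hasFDerivWithinAt_const _ _ _).congr hc (hc x hx)
  have e := hd.hasFDerivAt.hasFDerivWithinAt.unique_on h0 hu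
  have hl := hd.hasFDerivAt.hasLineDerivAt u
  rw [e] at hl
  exact (HasDerivAt.fun_sum (u := Finset.range n)
    fun j _ => hasDerivAt_log_snd hp u (j + 1)).unique hl

end Differential

section Forms

variable {n : ℕ}

theorem stdForm_apply (z : Target n) (v : Fin 2 → Target n) :
    stdForm n z v = ∑ i, ((v 0).2 i * (v 1).1 i - (v 1).2 i * (v 0).1 i) := by
  rw [stdForm, ContinuousAlternatingMap.sum_apply]
  exact Finset.sum_congr rfl fun i _ => wedge_apply _ _ _

theorem todaForm_apply [NeZero n] (x : Flaschka n) (v : Fin 2 → Flaschka n) :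
    todaForm n x v = 2 * ∑ i ∈ Finset.Icc 2 n, ∑ j ∈ Finset.Icc 1 (i - 1),
      ((v 0).1 (i : ZMod n) * logDerivA x (v 1) j - (v 1).1 (i : ZMod n) * logDerivA x (v 0) j) := by
  rw [todaForm, ContinuousAlternatingMap.smul_apply, ContinuousAlternatingMap.sum_apply, smul_eq_mul]
  congr 1
  refine Finset.sum_congr rfl fun i _ => ?_
  rw [ContinuousAlternatingMap.sum_apply]
  refine Finset.sum_congr rfl fun j _ => ?_
  rw [wedge_apply]
  simp only [logDerivA, div_eq_inv_mul]
  rfl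

theorem actionForm_apply (z : Target n) (v : Fin 1 → Target n) :
    actionForm n z v = ∑ i, z.1 i * (v 0).2 i := by
  rw [actionForm, oneForm_apply]
  simp [dμ]

theorem contDiff_actionForm (n : ℕ) : ContDiff ℝ ∞ (actionForm n) :=
  (ContinuousAlternatingMap.ofSubsingletonLIE (𝕜 := ℝ) (E := Target n) (F := ℝ) (0 : Fin 1)).contDiff.comp
    (ContDiff.sum fun i _ => ((contDiff_apply ℝ ℝ i).comp contDiff_fst).smul contDiff_const)

theorem extDeriv_actionForm (z : Target n) : extDeriv (actionForm n) z = -stdForm n z := by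
  ext v
  have hd : DifferentiableAt ℝ (actionForm n) z :=
    (contDiff_actionForm n).contDiffAt.differentiableAt (by simp)
  have hf : ∀ w : Fin 1 → Target n, ∀ y : Target n,
      fderiv ℝ (fun z => actionForm n z w) z y = ∑ i, y.1 i * (w 0).2 i := by
    intro w y
    have : HasFDerivAt (fun z => actionForm n z w) (∑ i, (w 0).2 i • df n i) z := by
      simp only [actionForm_apply]
      refine HasFDerivAt.fun_sum fun i _ => ?_
      exact ((df n i).hasFDerivAt (x := z)).mul_const ((w 0).2 i)
    rw [this.fderiv]
    simp [df, mul_comm]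
  rw [extDeriv_apply hd, Fin.sum_univ_two, hf, hf, ContinuousAlternatingMap.neg_apply, stdForm_apply,
    ← Finset.sum_neg_distrib]
  simp only [Fin.val_zero, pow_zero, one_smul, Fin.val_one, pow_one, neg_smul]
  rw [← sub_eq_add_neg, ← Finset.sum_sub_distrib]
  refine Finset.sum_congr rfl fun i _ => ?_
  simp only [Fin.removeNth]
  change (v 0).1 i * (v 1).2 i - (v 1).1 i * (v 0).2 i = _
  ring

theorem actionForm_compContinuousLinearMap {E : Type*} [NormedAddCommGroup E] [NormedSpace ℝ E]
    (z : Target n) (L : E →L[ℝ] Target n) :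
    (actionForm n z).compContinuousLinearMap L = oneForm ((∑ i, z.1 i • dμ n i).comp L) := rfl

variable [NeZero n] {α : ℝ} {x : Flaschka n}

theorem fderivWithin_floquetMap (hx : x ∈ phaseSpace n α) {u : Flaschka n}
    (hu : u ∈ tangentConeAt ℝ (phaseSpace n α) x) :
    fderivWithin ℝ floquetMap (phaseSpace n α) x u = fderiv ℝ floquetMap x u := by
  have hd := (contDiffAt_floquetMap (phaseSpace_subset n α hx)).differentiableAt (by simp)
  exact hd.differentiableWithinAt.hasFDerivWithinAt.unique_on hd.hasFDerivAt.hasFDerivWithinAt hu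

theorem stdForm_fderiv_floquetMap (hx : x ∈ phaseSpace n α) {v : Fin 2 → Flaschka n}
    (hv : ∀ i, v i ∈ tangentConeAt ℝ (phaseSpace n α) x) (z : Target n) :
    stdForm n z (fun i => fderiv ℝ floquetMap x (v i)) = todaForm n x v := by
  rw [stdForm_apply, todaForm_apply]
  exact sum_fderiv_wedge (phaseSpace_subset n α hx) (sum_logDerivA_eq_zero hx (hv 0))
    (sum_logDerivA_eq_zero hx (hv 1))

theorem pullbackForm_stdForm (hx : x ∈ phaseSpace n α) :
    FormEqAt (phaseSpace n α) x (pullbackForm floquetMap (phaseSpace n α) (stdForm n) x)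
      (todaForm n x) := by
  intro v hv
  rw [← stdForm_fderiv_floquetMap hx hv (floquetMap x)]
  change stdForm n _ (fun i => fderivWithin ℝ floquetMap (phaseSpace n α) x (v i)) = _
  simp only [fderivWithin_floquetMap hx (hv _)]

theorem isPrimitiveOn_actionForm (α : ℝ) :
    IsPrimitiveOn (phaseSpace n α)
      (fun x => -pullbackForm floquetMap (phaseSpace n α) (actionForm n) x) (todaForm n) := by
  intro x hx
  refine ⟨positiveRegion n, isOpen_positiveRegion n, phaseSpace_subset n α hx,
    -fun y => (actionForm n (floquetMap y)).compContinuousLinearMap (fderiv ℝ floquetMap y),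
    ?_, ?_, ?_⟩
  · simp only [actionForm_compContinuousLinearMap]
    have hφ := contDiffOn_floquetMap (n := n)
    have hφ' : ContDiffOn ℝ ∞ (fderiv ℝ floquetMap) (positiveRegion n) :=
      hφ.fderiv_of_isOpen (isOpen_positiveRegion n) (by simp)
    exact ((ContinuousAlternatingMap.ofSubsingletonLIE (𝕜 := ℝ) (E := Flaschka n) (F := ℝ)
      (0 : Fin 1)).contDiff.comp_contDiffOn
      ((ContDiffOn.sum fun i _ => (contDiffOn_pi.1 hφ.fst i).smul contDiffOn_const).clm_comp hφ')).neg
  · rintro y ⟨-, hy⟩ v hv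
    change -(actionForm n _ fun i => fderiv ℝ floquetMap y (v i)) =
      -(actionForm n _ fun i => fderivWithin ℝ floquetMap (phaseSpace n α) y (v i))
    simp only [fderivWithin_floquetMap hy (hv _)]
  · rintro y ⟨-, hy⟩ v hv
    have hd : extDeriv (fun y => (actionForm n (floquetMap y)).compContinuousLinearMap
        (fderiv ℝ floquetMap y)) y = _ :=
      extDeriv_pullback ((contDiff_actionForm n).contDiffAt.differentiableAt (by simp))
        (contDiffAt_floquetMap (phaseSpace_subset n α hy)) (r := ∞) (by
        rw [minSmoothness_of_isRCLikeNormedField]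
        exact WithTop.coe_le_coe.2 (le_top : (2 : ℕ∞) ≤ ⊤))
    rw [← neg_one_smul ℝ (fun y => (actionForm n (floquetMap y)).compContinuousLinearMap
        (fderiv ℝ floquetMap y)), extDeriv_smul, hd, extDeriv_actionForm, neg_one_smul]
    rw [← stdForm_fderiv_floquetMap hy hv (floquetMap y)]
    change -(-stdForm n _ fun i => fderiv ℝ floquetMap y (v i)) = _
    rw [neg_neg]

end Forms

end Toda

theorem theorem3p2 (n : ℕ) [NeZero n] (α : ℝ) (hα : 0 < α) :
    -- the data are well defined: `y₁(n+1, ·)` has degree `n - 1`, all its roots are real and they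
    -- are the `μ_i`, and `y₂(n+1, μ_i) ≠ 0`
    (∀ x ∈ Toda.phaseSpace n α,
      (Toda.y₁ x (n + 1)).natDegree = n - 1 ∧
      (Toda.y₁ x (n + 1)).roots = Finset.univ.val.map (Toda.dirichlet x) ∧
      ∀ i, (Toda.y₂ x (n + 1)).eval (Toda.dirichlet x i) ≠ 0) ∧
    -- the image
    Toda.floquetMap '' Toda.phaseSpace n α = {z : Toda.Target n | StrictMono z.2} ∧
    -- the symplectomorphism
    IsSymplectomorphismOn Toda.floquetMap (Toda.phaseSpace n α) (Toda.todaForm n)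
      (Toda.floquetMap '' Toda.phaseSpace n α) (Toda.stdForm n) ∧
    -- the primitive
    IsPrimitiveOn (Toda.phaseSpace n α)
      (fun x => -pullbackForm Toda.floquetMap (Toda.phaseSpace n α) (Toda.actionForm n) x)
      (Toda.todaForm n) := by
  refine ⟨fun x hx => ?_, Toda.floquetMap_image hα, ⟨?_, ?_, ?_, ?_⟩,
    Toda.isPrimitiveOn_actionForm α⟩
  · have hp := Toda.phaseSpace_subset n α hx
    exact ⟨Toda.natDegree_y₁_succ hp, Toda.roots_eq_map_dirichlet hp, Toda.y₂_ne_zero hp⟩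
  · exact Toda.floquetMap_injOn.bijOn_image
  · exact fun x hx => ⟨Toda.positiveRegion n, Toda.isOpen_positiveRegion n,
      Toda.phaseSpace_subset n α hx, Toda.floquetMap, Toda.contDiffOn_floquetMap, fun _ _ => rfl⟩
  · refine ⟨Toda.inverseMap n α, Toda.inverseMap_invOn hα, fun z hz => ?_⟩
    rw [Toda.floquetMap_image hα] at hz
    exact ⟨Toda.orderedRegion n, Toda.isOpen_orderedRegion n, hz, Toda.inverseMap n α,
      Toda.contDiffOn_inverseMap hα, fun _ _ => rfl⟩
  · exact fun x hx => Toda.pullbackForm_stdForm hx
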